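/- Let $R$ be a commutative ring, let $H^*(-)=\bigoplus_{n\ge 0}H^n(-;R)$ denote singular cohomology with coefficients in $R$, with the cup product, and let $p\colon E\to B$ be a surjective (Serre) fibration. The Schwarz genus $g(q)\in\{0,1,2,\dots,\infty\}$ of a continuous map $q\colon Y\to X$ is the least number of sets in a cover of $X$ by open sets over each of which $q$ has a continuous section ($\infty$ if there is no finite cover of this kind). For $\xi\in H^*(B)$, the sectional category weight $\mathrm{wgt}_p(\xi)\in\{0,1,2,\dots,\infty\}$ is the largest $k$ such that $f^*\xi=0$ for every continuous map $f\colon X\to B$ with $g(f^*p)\le k$, where $f^*p$ is the pullback of $p$ along $f$; it is $\infty$ if there are arbitrarily large such $k$, for instance if $\xi=0$. Then: 1. For every $\xi\in H^*(B)$: $\mathrm{wgt}_p(\xi)\ge 1$ if and only if $p^*\xi=0$ in $H^*(E)$. 2. For every nonzero $\xi\in H^*(B)$: $\mathrm{wgt}_p(\xi)<g(p)$; in particular $\mathrm{wgt}_p(\xi)$ is finite. 3. For all $l\ge 0$ and $\xi_1,\dots,\xi_l\in H^*(B)$: $\mathrm{wgt}_p(\xi_1\cdots\xi_l)\ge\sum_{i=1}^l\mathrm{wgt}_p(\xi_i)$.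 4. For all $l\ge 0$, if $\xi_1,\dots,\xi_l\in H^*(B)$ are homogeneous classes of positive degree with $\xi_1\cdots\xi_l\neq 0$, then $g(p)>\sum_{i=1}^l\mathrm{wgt}_p(\xi_i)$. -/

import Mathlib

open scoped DirectSum

universe u v

noncomputable section

/-! ### Singular cochains and the cup product -/

/-- Singular `n`-simplices of `X`: continuous maps from the standard `n`-simplex to `X`. -/
abbrev SingularSimplex (X : Type u) [TopologicalSpace X] (n : ℕ) : Type u :=
  C(stdSimplex ℝ (Fin (n + 1)), X)

/-- Precomposition of a singular simplex with the affine map of standard simplices that is given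
by a map of vertices. -/
def SingularSimplex.reindex {X : Type u} [TopologicalSpace X] {m n : ℕ}
    (σ : SingularSimplex X n) (g : Fin (m + 1) → Fin (n + 1)) : SingularSimplex X m :=
  σ.comp ⟨stdSimplex.map g, stdSimplex.continuous_map g⟩

/-- The `i`-th face of a singular simplex. -/
def SingularSimplex.face {X : Type u} [TopologicalSpace X] {n : ℕ}
    (σ : SingularSimplex X (n + 1)) (i : Fin (n + 2)) : SingularSimplex X n :=
  σ.reindex i.succAbove

/-- The front `n`-face `[v₀, …, vₙ]` of a singular `k`-simplex, for `n + m = k`. -/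
def SingularSimplex.front {X : Type u} [TopologicalSpace X] {n m k : ℕ} (h : n + m = k)
    (σ : SingularSimplex X k) : SingularSimplex X n :=
  σ.reindex fun i => ⟨i.1, by omega⟩

/-- The back `m`-face `[vₙ, …, vₙ₊ₘ]` of a singular `k`-simplex, for `n + m = k`. -/
def SingularSimplex.back {X : Type u} [TopologicalSpace X] {n m k : ℕ} (h : n + m = k)
    (σ : SingularSimplex X k) : SingularSimplex X m :=
  σ.reindex fun i => ⟨n + i.1, by omega⟩

theorem SingularSimplex.reindex_reindex {X : Type u} [TopologicalSpace X] {l m n : ℕ}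
    (σ : SingularSimplex X n) (g : Fin (m + 1) → Fin (n + 1)) (f : Fin (l + 1) → Fin (m + 1)) :
    (σ.reindex g).reindex f = σ.reindex (g ∘ f) := by
  ext x
  simp [SingularSimplex.reindex, stdSimplex.map_comp_apply]

/-- Singular `n`-cochains of `X` with coefficients in `R`. -/
abbrev SingularCochain (R : Type v) (X : Type u) [TopologicalSpace X] (n : ℕ) : Type (max u v) :=
  SingularSimplex X n → R

/-- The coboundary `(δφ)(σ) = ∑ (-1)^i φ(dᵢ σ)`. -/
def singularCoboundary (R : Type v) [CommRing R] (X : Type u) [TopologicalSpace X] (n : ℕ) :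
    SingularCochain R X n →ₗ[R] SingularCochain R X (n + 1) where
  toFun φ σ := ∑ i : Fin (n + 2), (-1) ^ (i : ℕ) * φ (σ.face i)
  map_add' φ ψ := by
    ext σ
    simp [mul_add, Finset.sum_add_distrib]
  map_smul' r φ := by
    ext σ
    simp [Finset.mul_sum, mul_left_comm]

/-- The cup product of cochains, `(φ ∪ ψ)(σ) = φ([v₀, …, vₙ]) ψ([vₙ, …, vₙ₊ₘ])`. -/
def SingularCochain.cup {R : Type v} [CommRing R] {X : Type u} [TopologicalSpace X]
    {n m k : ℕ} (h : n + m = k) (φ : SingularCochain R X n) (ψ : SingularCochain R X m) :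
    SingularCochain R X k :=
  fun σ => φ (σ.front h) * ψ (σ.back h)

/-- The Leibniz rule. -/
theorem singularCoboundary_cup {R : Type v} [CommRing R] {X : Type u} [TopologicalSpace X]
    {n m k : ℕ} (h : n + m = k) (φ : SingularCochain R X n) (ψ : SingularCochain R X m) :
    singularCoboundary R X k (φ.cup h ψ) =
      SingularCochain.cup (show n + 1 + m = k + 1 by omega) (singularCoboundary R X n φ) ψ +
        (-1 : R) ^ n • SingularCochain.cup (show n + (m + 1) = k + 1 by omega) φ
          (singularCoboundary R X m ψ) := by
  subst h
  ext σ
  have h1 : n + 1 + m = n + m + 1 := by omega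
  have h2 : n + (m + 1) = n + m + 1 := by omega
  have hc : n + 1 + (m + 1) = n + m + 2 := by omega
  have hfront : ∀ i : Fin (n + 1), ((σ.face (Fin.cast hc (Fin.castAdd (m + 1) i))).front rfl
      : SingularSimplex X n) = (σ.front h1).face i.castSucc := by
    intro i
    simp only [SingularSimplex.face, SingularSimplex.front, SingularSimplex.reindex_reindex]
    congr 1
    ext j
    simp only [Function.comp, Fin.succAbove, Fin.lt_def]
    simp
    split_ifs <;> rfl
  have hback : ∀ i : Fin (n + 1), ((σ.face (Fin.cast hc (Fin.castAdd (m + 1) i))).back rfl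
      : SingularSimplex X m) = σ.back h1 := by
    intro i
    simp only [SingularSimplex.face, SingularSimplex.back, SingularSimplex.reindex_reindex]
    congr 1
    ext j
    simp only [Function.comp, Fin.succAbove, Fin.lt_def]
    simp
    split_ifs <;> simp <;> omega
  have hfront' : ∀ i : Fin (m + 1), ((σ.face (Fin.cast hc (Fin.natAdd (n + 1) i))).front rfl
      : SingularSimplex X n) = σ.front h2 := by
    intro i
    simp only [SingularSimplex.face, SingularSimplex.front, SingularSimplex.reindex_reindex]
    congr 1
    ext j
    simp only [Function.comp, Fin.succAbove, Fin.lt_def]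
    simp
    split_ifs <;> simp <;> omega
  have hback' : ∀ i : Fin (m + 1), ((σ.face (Fin.cast hc (Fin.natAdd (n + 1) i))).back rfl
      : SingularSimplex X m) = (σ.back h2).face i.succ := by
    intro i
    simp only [SingularSimplex.face, SingularSimplex.back, SingularSimplex.reindex_reindex]
    congr 1
    ext j
    simp only [Function.comp, Fin.succAbove, Fin.lt_def]
    simp
    split_ifs <;> simp <;> omega
  have hlast : (σ.front h1).face (Fin.last (n + 1)) = (σ.front h2 : SingularSimplex X n) := by
    simp only [SingularSimplex.face, SingularSimplex.front, SingularSimplex.reindex_reindex]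
    congr 1
    ext j
    simp
  have hfirst : (σ.back h2).face 0 = (σ.back h1 : SingularSimplex X m) := by
    simp only [SingularSimplex.face, SingularSimplex.back, SingularSimplex.reindex_reindex]
    congr 1
    ext j
    simp
    omega
  simp only [singularCoboundary, LinearMap.coe_mk, AddHom.coe_mk, SingularCochain.cup,
    Pi.add_apply, Pi.smul_apply, smul_eq_mul]
  rw [← Equiv.sum_comp (finCongr hc), Fin.sum_univ_add, Fin.sum_univ_castSucc (n := n + 1),
    Fin.sum_univ_succ (n := m + 1), hlast, hfirst]
  simp only [finCongr_apply, hfront, hback, hfront', hback', Fin.val_cast, Fin.val_castAdd,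
    Fin.val_natAdd, Fin.val_castSucc, Fin.val_last, Fin.val_succ, Fin.val_zero, add_mul, mul_add,
    Finset.sum_mul, Finset.mul_sum, pow_add, pow_one, pow_zero]
  have e : ∀ a b : R, a + b = a + (-1) ^ n * -1 * φ (σ.front h2) * ψ (σ.back h1) +
      ((-1) ^ n * (φ (σ.front h2) * (1 * ψ (σ.back h1))) + b) := by
    intro a b; ring
  rw [e]
  congr 2
  · congr 1
    exact funext fun i => (mul_assoc _ _ _).symm
  · exact Finset.sum_congr rfl fun i _ => by ring

/-- The map of cochains induced by a continuous map. -/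
def SingularCochain.pullback (R : Type v) [CommRing R] {X Y : Type u} [TopologicalSpace X]
    [TopologicalSpace Y] (f : C(X, Y)) (n : ℕ) :
    SingularCochain R Y n →ₗ[R] SingularCochain R X n where
  toFun φ σ := φ (f.comp σ)
  map_add' _ _ := rfl
  map_smul' _ _ := rfl

theorem singularCoboundary_pullback (R : Type v) [CommRing R] {X Y : Type u} [TopologicalSpace X]
    [TopologicalSpace Y] (f : C(X, Y)) (n : ℕ) (φ : SingularCochain R Y n) :
    singularCoboundary R X n (SingularCochain.pullback R f n φ) =
      SingularCochain.pullback R f (n + 1) (singularCoboundary R Y n φ) := rfl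

/-! ### Singular cohomology -/

/-- Singular `n`-cocycles. -/
abbrev SingularCocycle (R : Type v) [CommRing R] (X : Type u) [TopologicalSpace X] (n : ℕ) :
    Submodule R (SingularCochain R X n) :=
  LinearMap.ker (singularCoboundary R X n)

/-- Singular `n`-coboundaries; in degree `0` only `0`. -/
def SingularBoundary (R : Type v) [CommRing R] (X : Type u) [TopologicalSpace X] :
    (n : ℕ) → Submodule R (SingularCochain R X n)
  | 0 => ⊥
  | n + 1 => LinearMap.range (singularCoboundary R X n)

/-- Singular cohomology `Hⁿ(X; R)`: cocycles modulo coboundaries. -/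
def SingularCohomology (R : Type v) [CommRing R] (X : Type u) [TopologicalSpace X] (n : ℕ) :
    Type (max u v) :=
  SingularCocycle R X n ⧸ (SingularBoundary R X n).submoduleOf (SingularCocycle R X n)

instance (R : Type v) [CommRing R] (X : Type u) [TopologicalSpace X] (n : ℕ) :
    AddCommGroup (SingularCohomology R X n) :=
  inferInstanceAs (AddCommGroup (_ ⧸ (SingularBoundary R X n).submoduleOf (SingularCocycle R X n)))

instance (R : Type v) [CommRing R] (X : Type u) [TopologicalSpace X] (n : ℕ) :
    Module R (SingularCohomology R X n) :=
  inferInstanceAs (Module R (_ ⧸ (SingularBoundary R X n).submoduleOf (SingularCocycle R X n)))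

/-- The cohomology class of a cocycle. -/
def SingularCohomology.mk (R : Type v) [CommRing R] (X : Type u) [TopologicalSpace X] (n : ℕ) :
    SingularCocycle R X n →ₗ[R] SingularCohomology R X n :=
  ((SingularBoundary R X n).submoduleOf (SingularCocycle R X n)).mkQ

/-- The homomorphism `f^* : Hⁿ(Y; R) → Hⁿ(X; R)` induced by a continuous map `f : X → Y`. -/
def SingularCohomology.pullback (R : Type v) [CommRing R] {X Y : Type u} [TopologicalSpace X]
    [TopologicalSpace Y] (f : C(X, Y)) (n : ℕ) :
    SingularCohomology R Y n →ₗ[R] SingularCohomology R X n :=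
  Submodule.mapQ _ _
    ((SingularCochain.pullback R f n).restrict fun φ hφ => by
      rw [LinearMap.mem_ker] at hφ ⊢
      rw [singularCoboundary_pullback, hφ, map_zero])
    (by
      rintro ⟨φ, hφ⟩ hb
      simp only [Submodule.mem_comap, Submodule.submoduleOf, Submodule.subtype_apply] at hb ⊢
      cases n with
      | zero =>
        have : φ = 0 := hb
        subst this
        exact map_zero (SingularCochain.pullback R f 0)
      | succ n =>
        obtain ⟨ψ, rfl⟩ := hb
        exact ⟨SingularCochain.pullback R f n ψ, rfl⟩)

/-- The cup product of cocycles, as a bilinear map. -/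
def SingularCocycle.cup (R : Type v) [CommRing R] (X : Type u) [TopologicalSpace X]
    {n m k : ℕ} (h : n + m = k) :
    SingularCocycle R X n →ₗ[R] SingularCocycle R X m →ₗ[R] SingularCocycle R X k :=
  LinearMap.mk₂ R
    (fun φ ψ => ⟨SingularCochain.cup h φ.1 ψ.1, by
      have h1 := LinearMap.mem_ker.1 φ.2
      have h2 := LinearMap.mem_ker.1 ψ.2
      rw [LinearMap.mem_ker, singularCoboundary_cup, h1, h2]
      ext σ
      simp [SingularCochain.cup]⟩)
    (fun _ _ _ => by ext σ; simp [SingularCochain.cup, add_mul])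
    (fun _ _ _ => by ext σ; simp [SingularCochain.cup, mul_assoc])
    (fun _ _ _ => by ext σ; simp [SingularCochain.cup, mul_add])
    (fun _ _ _ => by ext σ; simp [SingularCochain.cup, mul_left_comm])

theorem SingularCocycle.cup_mem_boundary_left (R : Type v) [CommRing R] (X : Type u)
    [TopologicalSpace X] {n m k : ℕ} (h : n + m = k) (φ : SingularCocycle R X n)
    (ψ : SingularCocycle R X m) (hφ : φ.1 ∈ SingularBoundary R X n) :
    SingularCochain.cup h φ.1 ψ.1 ∈ SingularBoundary R X k := by
  obtain ⟨φ, hφ'⟩ := φ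
  obtain ⟨ψ, hψ'⟩ := ψ
  rw [LinearMap.mem_ker] at hψ'
  cases n with
  | zero =>
    have : φ = 0 := hφ
    subst this
    convert Submodule.zero_mem _
    ext σ
    simp [SingularCochain.cup]
  | succ n =>
    obtain ⟨θ, rfl⟩ := hφ
    obtain rfl : n + m + 1 = k := by omega
    refine ⟨SingularCochain.cup rfl θ ψ, ?_⟩
    rw [singularCoboundary_cup, hψ']
    ext σ
    simp [SingularCochain.cup]

theorem SingularCocycle.cup_mem_boundary_right (R : Type v) [CommRing R] (X : Type u)
    [TopologicalSpace X] {n m k : ℕ} (h : n + m = k) (φ : SingularCocycle R X n)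
    (ψ : SingularCocycle R X m) (hψ : ψ.1 ∈ SingularBoundary R X m) :
    SingularCochain.cup h φ.1 ψ.1 ∈ SingularBoundary R X k := by
  obtain ⟨φ, hφ'⟩ := φ
  obtain ⟨ψ, hψ'⟩ := ψ
  rw [LinearMap.mem_ker] at hφ'
  cases m with
  | zero =>
    have : ψ = 0 := hψ
    subst this
    convert Submodule.zero_mem _
    ext σ
    simp [SingularCochain.cup]
  | succ m =>
    obtain ⟨θ, rfl⟩ := hψ
    obtain rfl : n + m + 1 = k := by omega
    refine ⟨(-1 : R) ^ n • SingularCochain.cup rfl φ θ, ?_⟩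
    rw [map_smul, singularCoboundary_cup, hφ', smul_add, smul_smul, ← mul_pow]
    ext σ
    simp [SingularCochain.cup]

/-- The cup product `Hⁿ(X; R) × Hᵐ(X; R) → Hⁿ⁺ᵐ(X; R)`, induced by the one of cocycles. -/
def SingularCohomology.cup (R : Type v) [CommRing R] (X : Type u) [TopologicalSpace X]
    (n m : ℕ) :
    SingularCohomology R X n →ₗ[R] SingularCohomology R X m →ₗ[R]
      SingularCohomology R X (n + m) :=
  Submodule.liftQ _
    (LinearMap.flip (Submodule.liftQ _
      (LinearMap.flip ((SingularCocycle.cup R X (rfl : n + m = n + m)).compr₂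
        (SingularCohomology.mk R X (n + m))))
      (by
        intro ψ hψ
        ext φ
        exact (Submodule.Quotient.mk_eq_zero _).2
          (SingularCocycle.cup_mem_boundary_right R X rfl φ ψ hψ))))
    (by
      intro φ hφ
      rw [LinearMap.mem_ker]
      ext x
      obtain ⟨ψ, rfl⟩ := Submodule.Quotient.mk_surjective _ x
      exact (Submodule.Quotient.mk_eq_zero _).2
        (SingularCocycle.cup_mem_boundary_left R X rfl φ ψ hφ))

theorem SingularCohomology.cup_mk (R : Type v) [CommRing R] (X : Type u) [TopologicalSpace X]
    (n m : ℕ) (φ : SingularCocycle R X n) (ψ : SingularCocycle R X m) :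
    SingularCohomology.cup R X n m (SingularCohomology.mk R X n φ) (SingularCohomology.mk R X m ψ) =
      SingularCohomology.mk R X (n + m) (SingularCocycle.cup R X rfl φ ψ) := rfl

/-- The unit class `1 ∈ H⁰(X; R)`, represented by the constant cochain `1`. -/
def SingularCohomology.unit (R : Type v) [CommRing R] (X : Type u) [TopologicalSpace X] :
    SingularCohomology R X 0 :=
  SingularCohomology.mk R X 0 ⟨fun _ => 1, by
    rw [LinearMap.mem_ker]
    ext σ
    simp [singularCoboundary, Fin.sum_univ_succ]⟩

instance (R : Type v) [CommRing R] (X : Type u) [TopologicalSpace X] :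
    DirectSum.GNonUnitalNonAssocSemiring (SingularCohomology R X) where
  mul {n m} a b := SingularCohomology.cup R X n m a b
  mul_zero _ := map_zero _
  zero_mul _ := by simp
  mul_add _ _ _ := map_add _ _ _
  add_mul _ _ _ := by simp

instance (R : Type v) [CommRing R] (X : Type u) [TopologicalSpace X] :
    GradedMonoid.GOne (SingularCohomology R X) where
  one := SingularCohomology.unit R X

/-- The total cohomology `H^*(X; R) = ⨁ₙ Hⁿ(X; R)`, with the cup product as multiplication. -/
abbrev TotalCohomology (R : Type v) [CommRing R] (X : Type u) [TopologicalSpace X] :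
    Type (max u v) :=
  ⨁ n : ℕ, SingularCohomology R X n

/-- The homomorphism `f^* : H^*(Y; R) → H^*(X; R)`. -/
def TotalCohomology.pullback (R : Type v) [CommRing R] {X Y : Type u} [TopologicalSpace X]
    [TopologicalSpace Y] (f : C(X, Y)) : TotalCohomology R Y →ₗ[R] TotalCohomology R X :=
  DirectSum.lmap fun n => SingularCohomology.pullback R f n

/-! ### Fibrations, Schwarz genus and sectional category weight -/

/-- A (Serre) fibration: a map with the homotopy lifting property for all cubes `I^n`. -/
def IsSerreFibration {E B : Type u} [TopologicalSpace E] [TopologicalSpace B] (p : C(E, B)) :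
    Prop :=
  ∀ (n : ℕ) (H : C((Fin n → unitInterval) × unitInterval, B)) (f : C(Fin n → unitInterval, E)), (∀ x, p (f x) = H (x, 0)) →
    ∃ F : C((Fin n → unitInterval) × unitInterval, E), (∀ x, F (x, 0) = f x) ∧ ∀ y, p (F y) = H y

/-- `p` has a continuous section over the subset `U` of its base. -/
def HasSectionOver {E B : Type u} [TopologicalSpace E] [TopologicalSpace B] (p : C(E, B))
    (U : Set B) : Prop :=
  ∃ s : C(U, E), ∀ x : U, p (s x) = x

/-- The base of `p` is covered by `k` open sets over each of which `p` has a section. -/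
def HasSectionalCover {E B : Type u} [TopologicalSpace E] [TopologicalSpace B] (p : C(E, B))
    (k : ℕ) : Prop :=
  ∃ U : Fin k → Set B, (∀ i, IsOpen (U i)) ∧ (⋃ i, U i) = Set.univ ∧
    ∀ i, HasSectionOver p (U i)

/-- The Schwarz genus `g(p)`: the least cardinality of a cover of the base by open sets over each
of which `p` has a continuous section, and `⊤` if there is no finite cover of this kind. -/
def schwarzGenus {E B : Type u} [TopologicalSpace E] [TopologicalSpace B] (p : C(E, B)) : ℕ∞ :=
  ⨅ (k : ℕ) (_ : HasSectionalCover p k), (k : ℕ∞)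

/-- The pullback `f^*p : f^*(E) → X` of `p : E → B` along `f : X → B`, where
`f^*(E) = {(x, e) | f x = p e}`. -/
def pullbackMap {E B X : Type u} [TopologicalSpace E] [TopologicalSpace B] [TopologicalSpace X]
    (f : C(X, B)) (p : C(E, B)) : C(Function.Pullback f p, X) :=
  ⟨fun z => z.1.1, by fun_prop⟩

/-- The property that defines the weight: `f^* ξ = 0` for every space `X` and every continuous
`f : X → B` such that `g(f^*p) ≤ k`. -/
def VanishesUpToGenus {R : Type v} [CommRing R] {E B : Type u} [TopologicalSpace E]
    [TopologicalSpace B] (p : C(E, B)) (ξ : TotalCohomology R B) (k : ℕ) : Prop :=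
  ∀ (X : Type u) [TopologicalSpace X] (f : C(X, B)), schwarzGenus (pullbackMap f p) ≤ k →
    TotalCohomology.pullback R f ξ = 0

/-- The sectional category weight `wgt_p(ξ)`: the largest `k` with `VanishesUpToGenus p ξ k`, and
`⊤` if there are arbitrarily large ones (for instance if `ξ = 0`). -/
def sectionalWeight {R : Type v} [CommRing R] {E B : Type u} [TopologicalSpace E]
    [TopologicalSpace B] (p : C(E, B)) (ξ : TotalCohomology R B) : ℕ∞ :=
  ⨆ (k : ℕ) (_ : VanishesUpToGenus p ξ k), (k : ℕ∞)

end

/-! Sections of `f^*p` over `U` are lifts of `f` restricted to `U`, so the genus of `f^*p` counts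
the open sets needed to lift `f` piecewise. Genus at most one means that `f` factors through `p`,
which gives the criterion for weight at least one.

For products, a cover by `k + l` sets splits into a union of `k` and a union of `l`. One factor dies
on the first union and the other on the second, so their cup product is zero
(`SingularCohomology.cup_eq_zero`). This rests on subdivision: a cocycle that vanishes on small
simplices is a coboundary (`SingularCochain.mem_boundary_of_small`). Induction gives
superadditivity, and the lower bound for `g(p)` follows from it and the strict inequality `wgt <
g(p)`.

If `g(p)` is finite, that inequality comes from testing on the identity of the base. If `g(p)` is
infinite, some test map of finite genus must detect the class. The test space is `FibrewiseJoin p (n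
+ 1)`, which has genus at most `n + 1` and lies in the same universe as the base. It detects degree
`n` for the following reason. Each singular simplex lifts through a surjective Serre fibration, but
the chosen lifts are not compatible with faces. Truncating small barycentric coordinates pushes a
neighbourhood of the interior of each truncated face into that face. Neighbourhoods of distinct
faces of equal dimension are disjoint, so the lifts of all `j`-faces together form the `j`-th
partial point. The result is a lift of truncated simplices to the join, natural in faces, in degrees
at most `n` (`joinLift`). Truncation is naturally homotopic to the identity, so a cocycle that
becomes a coboundary on the join is already one on the base
(`SingularCochain.mem_boundary_of_homotopy`).

The homotopies are built once for functions on tuples of points, where coning with an arbitrary apex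
contracts the augmented complex, and are carried to singular cochains by evaluation at vertices. -/

noncomputable section

/-! ### Cochains on tuples -/

section Tuple

variable {R : Type*} [CommRing R] {K L : Type*}

/-- The (augmented) coboundary of a function on `n`-tuples. -/
def tupleCoboundary (R : Type*) [CommRing R] (K : Type*) (n : ℕ) :
    ((Fin n → K) → R) →ₗ[R] ((Fin (n + 1) → K) → R) where
  toFun f v := ∑ i : Fin (n + 1), (-1) ^ (i : ℕ) * f (v ∘ i.succAbove)
  map_add' f g := by
    ext v
    simp [mul_add, Finset.sum_add_distrib]
  map_smul' r f := by
    ext v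
    simp [Finset.mul_sum, mul_left_comm]

theorem tupleCoboundary_apply (n : ℕ) (f : (Fin n → K) → R) (v : Fin (n + 1) → K) :
    tupleCoboundary R K n f v = ∑ i : Fin (n + 1), (-1) ^ (i : ℕ) * f (v ∘ i.succAbove) := rfl

/-- Restriction of a function on tuples to the tuples with first entry `b`. -/
def tupleCone (R : Type*) [CommRing R] {K : Type*} (b : K) (n : ℕ) :
    ((Fin (n + 1) → K) → R) →ₗ[R] ((Fin n → K) → R) :=
  LinearMap.funLeft R R fun w => (Fin.cons b w : Fin (n + 1) → K)

theorem tupleCone_apply (b : K) (n : ℕ) (f : (Fin (n + 1) → K) → R) (v : Fin n → K) :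
    tupleCone R b n f v = f (Fin.cons b v) := rfl

theorem cons_comp_succ_succAbove {n : ℕ} (b : K) (v : Fin (n + 1) → K) (i : Fin (n + 1)) :
    (Fin.cons b v : Fin (n + 2) → K) ∘ i.succ.succAbove = Fin.cons b (v ∘ i.succAbove) := by
  ext j
  refine Fin.cases ?_ (fun j => ?_) j
  · simp
  · simp

/-- An `n`-tuple plays the role of an `(n - 1)`-simplex. The empty tuple supplies the augmentation,
so coning contracts the complex in its lowest degree as well. -/
theorem tupleCone_coboundary_zero (b : K) (f : (Fin 0 → K) → R) :
    tupleCone R b 0 (tupleCoboundary R K 0 f) = f := by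
  ext v
  rw [tupleCone_apply, tupleCoboundary_apply, Fin.sum_univ_one]
  simp only [Fin.val_zero, pow_zero, one_mul]
  exact congrArg f (Subsingleton.elim _ _)

/-- Omitting the apex of a cone gives back `f`; every other face is the cone on a face, with the
opposite sign. -/
theorem tupleCone_coboundary (b : K) (n : ℕ) (f : (Fin (n + 1) → K) → R) :
    tupleCone R b (n + 1) (tupleCoboundary R K (n + 1) f) =
      f - tupleCoboundary R K n (tupleCone R b n f) := by
  ext v
  rw [tupleCone_apply, tupleCoboundary_apply, Fin.sum_univ_succ, Pi.sub_apply,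
    tupleCoboundary_apply, sub_eq_add_neg, ← Finset.sum_neg_distrib]
  congr 1
  · simp only [Fin.val_zero, pow_zero, one_mul]
    congr 1
  · refine Finset.sum_congr rfl fun i _ => ?_
    rw [cons_comp_succ_succAbove, Fin.val_succ, pow_succ, tupleCone_apply]
    ring

/-- Every nonempty tuple starts with some `b`, so identities may be checked after coning. This gives
`δδ = 0` by induction, without a double sum over pairs of faces. -/
theorem eq_of_tupleCone_eq {n : ℕ} {f g : (Fin (n + 1) → K) → R}
    (h : ∀ b, tupleCone R b n f = tupleCone R b n g) : f = g := by
  ext v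
  rw [← Fin.cons_self_tail v]
  exact congrFun (h (v 0)) (Fin.tail v)

theorem tupleCoboundary_tupleCoboundary (n : ℕ) (f : (Fin n → K) → R) :
    tupleCoboundary R K (n + 1) (tupleCoboundary R K n f) = 0 := by
  induction n with
  | zero =>
    refine eq_of_tupleCone_eq fun b => ?_
    rw [tupleCone_coboundary, tupleCone_coboundary_zero, sub_self, map_zero]
  | succ n ih =>
    refine eq_of_tupleCone_eq fun b => ?_
    rw [tupleCone_coboundary, tupleCone_coboundary, map_sub, ih, sub_zero, sub_self, map_zero]

/-- A null-homotopy of a cochain map `Θ` that vanishes on the augmentation, constructed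
recursively with cones with apex `c v`. -/
def tupleHomotopy (Θ : ∀ n, ((Fin n → L) → R) →ₗ[R] ((Fin n → K) → R))
    (c : ∀ n, (Fin (n + 1) → K) → L) : ∀ n, ((Fin (n + 1) → L) → R) →ₗ[R] ((Fin n → K) → R)
  | 0 => 0
  | n + 1 => LinearMap.pi fun v => LinearMap.proj v ∘ₗ
      (Θ (n + 1) - tupleCoboundary R K n ∘ₗ tupleHomotopy Θ c n) ∘ₗ tupleCone R (c n v) (n + 1)

theorem tupleHomotopy_succ_apply (Θ : ∀ n, ((Fin n → L) → R) →ₗ[R] ((Fin n → K) → R))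
    (c : ∀ n, (Fin (n + 1) → K) → L) (n : ℕ) (f : (Fin (n + 2) → L) → R) (v : Fin (n + 1) → K) :
    tupleHomotopy Θ c (n + 1) f v = Θ (n + 1) (tupleCone R (c n v) (n + 1) f) v -
      tupleCoboundary R K n (tupleHomotopy Θ c n (tupleCone R (c n v) (n + 1) f)) v := rfl

/-- For one `v` at a time the apex is fixed, and the cone formula yields `Θ f - δ h f` plus terms
that cancel by induction and `δδ = 0`. In the lowest degree the homotopy is zero, which is
consistent because of `h0`. -/
theorem tupleHomotopy_spec (Θ : ∀ n, ((Fin n → L) → R) →ₗ[R] ((Fin n → K) → R))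
    (c : ∀ n, (Fin (n + 1) → K) → L)
    (hΘ : ∀ n f, Θ (n + 1) (tupleCoboundary R L n f) = tupleCoboundary R K n (Θ n f))
    (h0 : Θ 0 = 0) (n : ℕ) (f : (Fin (n + 1) → L) → R) :
    tupleHomotopy Θ c (n + 1) (tupleCoboundary R L (n + 1) f) +
      tupleCoboundary R K n (tupleHomotopy Θ c n f) = Θ (n + 1) f := by
  induction n with
  | zero =>
    ext v
    rw [Pi.add_apply, tupleHomotopy_succ_apply, tupleCone_coboundary, map_sub, hΘ, h0]
    simp [tupleHomotopy]
  | succ n ih =>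
    ext v
    have ih' := ih (tupleCone R (c (n + 1) v) (n + 1) f)
    rw [Pi.add_apply, tupleHomotopy_succ_apply, tupleCone_coboundary, map_sub, map_sub, hΘ, ← ih',
      map_add, map_sub, tupleCoboundary_tupleCoboundary]
    simp only [Pi.sub_apply, Pi.add_apply, Pi.zero_apply]
    ring

theorem tupleCone_comp (g : K → L) (b : K) (n : ℕ) (f : (Fin (n + 1) → L) → R) :
    tupleCone R b n (fun v => f (g ∘ v)) = fun v => tupleCone R (g b) n f (g ∘ v) := by
  ext v
  simp only [tupleCone_apply, Fin.comp_cons]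

/-- Naturality of the recursive null-homotopy. -/
theorem tupleHomotopy_comp {K' L' : Type*}
    (Θ : ∀ n, ((Fin n → L) → R) →ₗ[R] ((Fin n → K) → R)) (c : ∀ n, (Fin (n + 1) → K) → L)
    (Θ' : ∀ n, ((Fin n → L') → R) →ₗ[R] ((Fin n → K') → R)) (c' : ∀ n, (Fin (n + 1) → K') → L')
    (g : K → K') (g' : L → L')
    (hΘ : ∀ n (f : (Fin n → L') → R) v, Θ n (fun w => f (g' ∘ w)) v = Θ' n f (g ∘ v))
    (hc : ∀ n v, g' (c n v) = c' n (g ∘ v)) (n : ℕ) (f : (Fin (n + 1) → L') → R) (v : Fin n → K) :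
    tupleHomotopy Θ c n (fun w => f (g' ∘ w)) v = tupleHomotopy Θ' c' n f (g ∘ v) := by
  induction n with
  | zero => rfl
  | succ n ih =>
    rw [tupleHomotopy_succ_apply, tupleHomotopy_succ_apply, tupleCone_comp, hΘ, hc]
    congr 1
    rw [show tupleHomotopy Θ c n (fun v_1 => tupleCone R (c' n (g ∘ v)) (n + 1) f (g' ∘ v_1)) =
      fun w => tupleHomotopy Θ' c' n (tupleCone R (c' n (g ∘ v)) (n + 1) f) (g ∘ w) from
      funext fun w => ih _ w]
    rfl

/-- Barycentric subdivision of functions on tuples, for a given notion of barycentre. -/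
def tupleSubdivision (R : Type*) [CommRing R] {K : Type*} (b : ∀ n, (Fin (n + 1) → K) → K) :
    ∀ n, ((Fin n → K) → R) →ₗ[R] ((Fin n → K) → R)
  | 0 => LinearMap.id
  | n + 1 => LinearMap.pi fun v => LinearMap.proj v ∘ₗ tupleCoboundary R K n ∘ₗ
      tupleSubdivision R b n ∘ₗ tupleCone R (b n v) n

theorem tupleSubdivision_succ_apply (b : ∀ n, (Fin (n + 1) → K) → K) (n : ℕ)
    (f : (Fin (n + 1) → K) → R) (v : Fin (n + 1) → K) :
    tupleSubdivision R b (n + 1) f v =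
      tupleCoboundary R K n (tupleSubdivision R b n (tupleCone R (b n v) n f)) v := rfl

/-- The dual of `∂ Sd = Sd ∂`. By the cone formula and induction, the error is `δδ` of the
subdivided cone. -/
theorem tupleSubdivision_coboundary (b : ∀ n, (Fin (n + 1) → K) → K) (n : ℕ)
    (f : (Fin n → K) → R) :
    tupleSubdivision R b (n + 1) (tupleCoboundary R K n f) =
      tupleCoboundary R K n (tupleSubdivision R b n f) := by
  induction n with
  | zero =>
    ext v
    rw [tupleSubdivision_succ_apply, tupleCone_coboundary_zero]
  | succ n ih =>
    ext v
    rw [tupleSubdivision_succ_apply, tupleCone_coboundary, map_sub, map_sub, ih,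
      tupleCoboundary_tupleCoboundary, sub_zero]

theorem tupleSubdivision_comp (b : ∀ n, (Fin (n + 1) → K) → K) (b' : ∀ n, (Fin (n + 1) → L) → L)
    (g : K → L) (hb : ∀ n v, g (b n v) = b' n (g ∘ v)) (n : ℕ) (f : (Fin n → L) → R) :
    tupleSubdivision R b n (fun w => f (g ∘ w)) =
      fun v => tupleSubdivision R b' n f (g ∘ v) := by
  induction n with
  | zero => rfl
  | succ n ih =>
    ext v
    rw [tupleSubdivision_succ_apply, tupleCone_comp, ih, hb]
    rfl

theorem tupleSubdivision_iterate_comp (b : ∀ n, (Fin (n + 1) → K) → K)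
    (b' : ∀ n, (Fin (n + 1) → L) → L)
    (g : K → L) (hb : ∀ n v, g (b n v) = b' n (g ∘ v)) (n i : ℕ) (f : (Fin n → L) → R) :
    (tupleSubdivision R b n)^[i] (fun w => f (g ∘ w)) =
      fun v => (tupleSubdivision R b' n)^[i] f (g ∘ v) := by
  induction i generalizing f with
  | zero => rfl
  | succ i ih =>
    rw [Function.iterate_succ_apply, Function.iterate_succ_apply,
      tupleSubdivision_comp b b' g hb, ih]

theorem tupleSubdivision_iterate_coboundary (b : ∀ n, (Fin (n + 1) → K) → K) (n i : ℕ)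
    (f : (Fin n → K) → R) :
    (tupleSubdivision R b (n + 1))^[i] (tupleCoboundary R K n f) =
      tupleCoboundary R K n ((tupleSubdivision R b n)^[i] f) := by
  induction i generalizing f with
  | zero => rfl
  | succ i ih =>
    rw [Function.iterate_succ_apply, Function.iterate_succ_apply, tupleSubdivision_coboundary, ih]

/-- Barycentric subdivision shrinks simplices. -/
theorem tupleSubdivision_apply_eq_zero {V : Type*} [NormedAddCommGroup V] [NormedSpace ℝ V]
    (ι : K → V) (b : ∀ n, (Fin (n + 1) → K) → K)
    (hb : ∀ n v, ι (b n v) = (n + 1 : ℝ)⁻¹ • ∑ i, ι (v i)) (r : ℝ) (n : ℕ)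
    (hr : (n : ℝ) ≤ r * (n + 1)) (D : ℝ) (hD : 0 ≤ D) (m : ℕ) (hm : m ≤ n + 1) (v : Fin m → K)
    (f : (Fin m → K) → R) (hv : ∀ i j, ‖ι (v i) - ι (v j)‖ ≤ D)
    (hf : ∀ w : Fin m → K, (∀ i, ι (w i) ∈ convexHull ℝ (Set.range (ι ∘ v))) →
      (∀ i j, ‖ι (w i) - ι (w j)‖ ≤ r * D) → f w = 0) :
    tupleSubdivision R b m f v = 0 := by
  have hr0 : 0 ≤ r := by
    by_contra! h
    nlinarith [(Nat.cast_nonneg n : (0 : ℝ) ≤ n)]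
  induction m with
  | zero => exact hf v (fun i => i.elim0) (fun i => i.elim0)
  | succ m ih =>
    rw [tupleSubdivision_succ_apply, tupleCoboundary_apply]
    refine Finset.sum_eq_zero fun i _ => ?_
    rw [ih (by omega) (v ∘ i.succAbove) _ (fun j k => hv (i.succAbove j) (i.succAbove k)) ?_,
      mul_zero]
    -- The tuples that occur are the barycentre followed by a tuple `w` from the subdivision of a
    -- face. Knowing that `w` lies in the convex hull is what bounds its distance to the barycentre.
    intro w hw1 hw2
    -- The ratio `m / (m + 1)` increases with `m`, so the factor chosen for `n` serves all shorter
    -- tuples.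
    have hmr : (m : ℝ) ≤ r * (m + 1) := by
      have h1 : (m : ℝ) ≤ n := by exact_mod_cast (by omega : m ≤ n)
      have h2 : (0 : ℝ) ≤ m := Nat.cast_nonneg m
      have h3 : (0 : ℝ) ≤ n := Nat.cast_nonneg n
      have h4 : (m : ℝ) * (n + 1) ≤ n * (m + 1) := by nlinarith
      have h5 : (m : ℝ) * (n + 1) ≤ (r * (m + 1)) * (n + 1) := by nlinarith
      exact le_of_mul_le_mul_right h5 (by positivity)
    have hm0 : (0 : ℝ) < m + 1 := by positivity
    have hbary : ι (b m v) ∈ convexHull ℝ (Set.range (ι ∘ v)) := by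
      rw [hb, Finset.smul_sum]
      refine (convex_convexHull ℝ _).sum_mem (fun _ _ => by positivity) ?_
        (fun j _ => subset_convexHull ℝ _ ⟨j, rfl⟩)
      simp
      field_simp
    have hdist : ∀ x ∈ convexHull ℝ (Set.range (ι ∘ v)), ‖x - ι (b m v)‖ ≤ r * D := by
      suffices convexHull ℝ (Set.range (ι ∘ v)) ⊆ Metric.closedBall (ι (b m v)) (r * D) from
        fun x hx => by simpa [dist_eq_norm] using this hx
      refine convexHull_min ?_ (convex_closedBall _ _)
      rintro _ ⟨j, rfl⟩
      rw [Metric.mem_closedBall, dist_eq_norm]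
      -- The summand `k = j` vanishes. Only `m` differences of norm at most `D` remain, which gives
      -- the factor `m / (m + 1)`.
      have e : (ι ∘ v) j - ι (b m v) = (m + 1 : ℝ)⁻¹ • ∑ k, (ι (v j) - ι (v k)) := by
        rw [hb, Finset.sum_sub_distrib, smul_sub, Finset.sum_const, Finset.card_univ,
          Fintype.card_fin, ← Nat.cast_smul_eq_nsmul ℝ, smul_smul]
        push_cast
        rw [inv_mul_cancel₀ hm0.ne', one_smul]
        rfl
      rw [e, norm_smul, norm_inv, Real.norm_of_nonneg hm0.le, inv_mul_le_iff₀ hm0]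
      rw [← Fin.sum_univ_succAbove _ j |>.symm]
      rw [sub_self, zero_add]
      refine (norm_sum_le_of_le _ fun k _ => hv j _).trans ?_
      simp only [Finset.sum_const, Finset.card_univ, Fintype.card_fin, nsmul_eq_mul]
      nlinarith
    have hw1' : ∀ j, ι (w j) ∈ convexHull ℝ (Set.range (ι ∘ v)) := fun j =>
      convexHull_mono (by rintro _ ⟨k, rfl⟩; exact ⟨_, rfl⟩) (hw1 j)
    refine hf _ (fun j => ?_) (fun j k => ?_)
    · refine Fin.cases ?_ (fun j => ?_) j
      · exact hbary
      · exact hw1' j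
    · refine Fin.cases ?_ (fun j => ?_) j <;> refine Fin.cases ?_ (fun k => ?_) k
      · simpa using mul_nonneg hr0 hD
      · simp only [Fin.cons_zero, Fin.cons_succ]
        rw [norm_sub_rev]
        exact hdist _ (hw1' k)
      · simp only [Fin.cons_zero, Fin.cons_succ]
        exact hdist _ (hw1' j)
      · simpa using hw2 j k

theorem tupleSubdivision_iterate_apply_eq_zero {V : Type*} [NormedAddCommGroup V]
    [NormedSpace ℝ V] (ι : K → V) (b : ∀ n, (Fin (n + 1) → K) → K)
    (hb : ∀ n v, ι (b n v) = (n + 1 : ℝ)⁻¹ • ∑ i, ι (v i)) (r : ℝ) (n : ℕ)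
    (hr0 : 0 ≤ r) (hr : (n : ℝ) ≤ r * (n + 1)) (k : ℕ) (D : ℝ) (hD : 0 ≤ D)
    (v : Fin (n + 1) → K)
    (f : (Fin (n + 1) → K) → R) (hv : ∀ i j, ‖ι (v i) - ι (v j)‖ ≤ D)
    (hf : ∀ w : Fin (n + 1) → K, (∀ i j, ‖ι (w i) - ι (w j)‖ ≤ r ^ k * D) → f w = 0) :
    (tupleSubdivision R b (n + 1))^[k] f v = 0 := by
  induction k generalizing D v with
  | zero => exact hf v (by simpa using hv)
  | succ k ih =>
    rw [Function.iterate_succ_apply']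
    refine tupleSubdivision_apply_eq_zero ι b hb r n hr D hD _ le_rfl v _ hv fun w _ hw => ?_
    refine ih (r * D) (by positivity) w hw fun w' hw' => hf w' fun i j => ?_
    rw [pow_succ, mul_assoc]
    exact hw' i j

end Tuple

/-! ### Affine simplices -/

section Affine

variable {X Y : Type*} [Fintype X] [Fintype Y]

/-- The affine map of standard simplices with given images of the vertices. -/
def affineSimplex {n : ℕ} (v : Fin n → stdSimplex ℝ X) :
    C(stdSimplex ℝ (Fin n), stdSimplex ℝ X) where
  toFun y := ⟨∑ i, y i • (v i : X → ℝ),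
    (convex_stdSimplex ℝ X).sum_mem (fun i _ => y.2.1 i) y.2.2 fun i _ => (v i).2⟩
  continuous_toFun := by
    refine Continuous.subtype_mk (continuous_finsetSum _ fun i _ => ?_) _
    exact ((continuous_apply i).comp continuous_subtype_val).smul continuous_const

theorem affineSimplex_coe {n : ℕ} (v : Fin n → stdSimplex ℝ X) (y : stdSimplex ℝ (Fin n)) :
    (affineSimplex v y : X → ℝ) = ∑ i, y i • (v i : X → ℝ) := rfl

theorem sum_linearMap_smul {V : Type*} [AddCommMonoid V] [Module ℝ V] (g : X → Y) (y : X → ℝ)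
    (w : Y → V) :
    ∑ j, FunOnFinite.linearMap ℝ ℝ g y j • w j = ∑ i, y i • w (g i) := by
  classical
  simp only [FunOnFinite.linearMap_apply_apply, Finset.sum_smul]
  rw [← Finset.sum_fiberwise Finset.univ g (fun i => y i • w (g i))]
  refine Finset.sum_congr rfl fun j _ => Finset.sum_congr rfl fun i hi => ?_
  rw [(Finset.mem_filter.1 hi).2]

theorem affineSimplex_map {m n : ℕ} (v : Fin n → stdSimplex ℝ X) (g : Fin m → Fin n)
    (y : stdSimplex ℝ (Fin m)) :
    affineSimplex v (stdSimplex.map g y) = affineSimplex (v ∘ g) y :=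
  Subtype.ext (sum_linearMap_smul g y fun j => (v j : X → ℝ))

theorem map_affineSimplex {n : ℕ} (g : X → Y) (v : Fin n → stdSimplex ℝ X)
    (y : stdSimplex ℝ (Fin n)) :
    stdSimplex.map g (affineSimplex v y) = affineSimplex (stdSimplex.map g ∘ v) y := by
  refine Subtype.ext ?_
  change FunOnFinite.linearMap ℝ ℝ g (∑ i, y i • (v i : X → ℝ)) =
    ∑ i, y i • FunOnFinite.linearMap ℝ ℝ g (v i : X → ℝ)
  simp only [map_sum, map_smul]

theorem affineSimplex_vertex {n : ℕ} (y : stdSimplex ℝ (Fin n)) :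
    affineSimplex (fun i => stdSimplex.vertex (S := ℝ) i) y = y := by
  refine Subtype.ext ?_
  change ∑ i, y i • (Pi.single i 1 : Fin n → ℝ) = fun i => y i
  ext j
  simp [Finset.sum_apply, Pi.single_apply]

theorem affineSimplex_const {n : ℕ} (x : stdSimplex ℝ X) (y : stdSimplex ℝ (Fin n)) :
    affineSimplex (fun _ => x) y = x := by
  refine Subtype.ext ?_
  change ∑ i, y i • (x : X → ℝ) = x
  rw [← Finset.sum_smul, stdSimplex.sum_eq_one, one_smul]

/-- The barycentre of a tuple of points. -/
def tupleBarycenter (n : ℕ) (v : Fin (n + 1) → stdSimplex ℝ X) : stdSimplex ℝ X :=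
  affineSimplex v stdSimplex.barycenter

theorem tupleBarycenter_coe (n : ℕ) (v : Fin (n + 1) → stdSimplex ℝ X) :
    (tupleBarycenter n v : X → ℝ) = (n + 1 : ℝ)⁻¹ • ∑ i, (v i : X → ℝ) := by
  rw [tupleBarycenter, affineSimplex_coe, Finset.smul_sum]
  refine Finset.sum_congr rfl fun i _ => ?_
  congr 1
  change ((Fintype.card (Fin (n + 1)) : ℝ)⁻¹ : ℝ) = _
  simp

theorem map_tupleBarycenter (g : X → Y) (n : ℕ) (v : Fin (n + 1) → stdSimplex ℝ X) :
    stdSimplex.map g (tupleBarycenter n v) = tupleBarycenter n (stdSimplex.map g ∘ v) :=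
  map_affineSimplex g v _

end Affine

/-! ### Small simplices -/

section Small

variable {R : Type v} {X : Type u} [TopologicalSpace X]

/-- The function on tuples of points of a standard simplex that is induced by a singular cochain
and a singular simplex. -/
def SingularCochain.onTuples {n k : ℕ} (φ : SingularCochain R X n) (σ : SingularSimplex X k) :
    (Fin (n + 1) → stdSimplex ℝ (Fin (k + 1))) → R :=
  fun v => φ (σ.comp (affineSimplex v))

theorem SingularCochain.onTuples_reindex {n k m : ℕ} (φ : SingularCochain R X n)
    (σ : SingularSimplex X k) (g : Fin (m + 1) → Fin (k + 1)) :
    φ.onTuples (σ.reindex g) = fun v => φ.onTuples σ (stdSimplex.map g ∘ v) := by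
  ext v
  refine congrArg φ ?_
  ext y
  exact congrArg σ (map_affineSimplex g v y)

/-- Evaluation at the vertices recovers the cochain, so identities between tuple operators become
identities of singular cochains. -/
theorem SingularCochain.onTuples_vertex {n : ℕ} (φ : SingularCochain R X n)
    (σ : SingularSimplex X n) : φ.onTuples σ (fun i => stdSimplex.vertex i) = φ σ := by
  refine congrArg φ ?_
  ext y
  exact congrArg σ (affineSimplex_vertex y)

variable [CommRing R]

theorem singularCoboundary_apply (n : ℕ) (φ : SingularCochain R X n)
    (σ : SingularSimplex X (n + 1)) :
    singularCoboundary R X n φ σ = ∑ i : Fin (n + 2), (-1) ^ (i : ℕ) * φ (σ.face i) := rfl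

theorem SingularCochain.onTuples_coboundary {n k : ℕ} (φ : SingularCochain R X n)
    (σ : SingularSimplex X k) :
    SingularCochain.onTuples (singularCoboundary R X n φ) σ =
      tupleCoboundary R _ (n + 1) (φ.onTuples σ) := by
  ext v
  rw [SingularCochain.onTuples, singularCoboundary_apply, tupleCoboundary_apply]
  refine Finset.sum_congr rfl fun i _ => congrArg _ (congrArg φ ?_)
  ext y
  exact congrArg σ (affineSimplex_map v i.succAbove y)

theorem map_comp_vertex {m n : ℕ} (g : Fin m → Fin n) :
    (stdSimplex.map g ∘ fun i => stdSimplex.vertex (S := ℝ) i) =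
      (fun i => stdSimplex.vertex (S := ℝ) i) ∘ g :=
  funext fun i => stdSimplex.map_vertex g i

/-- Iterated subdivision of a cochain that vanishes on small simplices is eventually zero on each
singular simplex. -/
theorem SingularCochain.exists_iterate_eq_zero {ι : Type*} (U : ι → Set X)
    (hU : ∀ i, IsOpen (U i)) (hcov : ⋃ i, U i = Set.univ) {n k : ℕ} (θ : SingularCochain R X n)
    (hθ : ∀ σ : SingularSimplex X n, (∃ i, ∀ y, σ y ∈ U i) → θ σ = 0) (σ : SingularSimplex X k) :
    ∃ N, ∀ i ≥ N, (tupleSubdivision R tupleBarycenter (n + 1))^[i] (θ.onTuples σ) = 0 := by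
  obtain ⟨ε, hε, hball⟩ := lebesgue_number_lemma_of_metric (s := Set.univ)
    (c := fun i => σ ⁻¹' U i) isCompact_univ (fun i => (hU i).preimage σ.continuous)
    (by rw [← Set.preimage_iUnion, hcov]; exact fun _ _ => trivial)
  have hn : (0 : ℝ) < n + 1 := by positivity
  -- The shrinking factor of barycentric subdivision in dimension `n`. The standard simplex has
  -- diameter at most `1` in the sup norm, so `i` subdivisions reduce to tuples of diameter at most
  -- `r ^ i`.
  set r : ℝ := n / (n + 1) with hr
  have hr0 : 0 ≤ r := by positivity
  have hr1 : r < 1 := by rw [hr, div_lt_one hn]; linarith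
  obtain ⟨N, hN⟩ := exists_pow_lt_of_lt_one (half_pos hε) hr1
  refine ⟨N, fun i hi => ?_⟩
  ext v
  refine tupleSubdivision_iterate_apply_eq_zero
    (fun x : stdSimplex ℝ (Fin (k + 1)) => (x : Fin (k + 1) → ℝ)) tupleBarycenter
    tupleBarycenter_coe r n hr0 (by rw [hr, div_mul_cancel₀ _ hn.ne']) i 1 zero_le_one v _
    (fun a b => ?_) (fun w hw => ?_)
  · rw [← dist_eq_norm]
    exact (Metric.dist_le_diam_of_mem (bounded_stdSimplex _) (v a).2 (v b).2).trans
      diam_stdSimplex_le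
  · refine hθ _ ?_
    obtain ⟨j, hj⟩ := hball (w 0) trivial
    refine ⟨j, fun y => hj ?_⟩
    rw [Metric.mem_ball, Subtype.dist_eq]
    have hlt : r ^ i * 1 < ε := by
      rw [mul_one]
      exact (pow_le_pow_of_le_one hr0 hr1.le hi).trans_lt (hN.trans (half_lt_self hε))
    refine lt_of_le_of_lt ?_ hlt
    rw [← Metric.mem_closedBall]
    refine (convex_closedBall _ _).sum_mem (fun i _ => y.2.1 i) y.2.2 fun i _ => ?_
    rw [Metric.mem_closedBall, dist_eq_norm]
    exact hw i 0

/-- A cocycle that vanishes on the singular simplices contained in some member of an open cover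
is a coboundary. -/
theorem SingularCochain.mem_boundary_of_small {ι : Type*} (U : ι → Set X)
    (hU : ∀ i, IsOpen (U i)) (hcov : ⋃ i, U i = Set.univ) {n : ℕ} (θ : SingularCochain R X n)
    (hδ : singularCoboundary R X n θ = 0)
    (hθ : ∀ σ : SingularSimplex X n, (∃ i, ∀ y, σ y ∈ U i) → θ σ = 0) :
    θ ∈ SingularBoundary R X n := by
  cases n with
  | zero =>
    -- A `0`-simplex is a point, hence already lies in a member of the cover.
    have : θ = 0 := by
      ext σ
      refine hθ σ ?_
      obtain ⟨i, hi⟩ := Set.mem_iUnion.1 (hcov ▸ Set.mem_univ (σ (stdSimplex.vertex 0)))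
      exact ⟨i, fun y => by rwa [Subsingleton.elim y (stdSimplex.vertex 0)]⟩
    exact this
  | succ n =>
    let S : ∀ k : ℕ, _ →ₗ[R] ((Fin (n + 2) → stdSimplex ℝ (Fin (k + 1))) → R) :=
      fun k => tupleSubdivision R tupleBarycenter (n + 2)
    let Θ : ∀ k m : ℕ, ((Fin m → stdSimplex ℝ (Fin (k + 1))) → R) →ₗ[R] _ :=
      fun k m => LinearMap.id - tupleSubdivision R tupleBarycenter m
    -- A homotopy between the identity and subdivision. The apex `v 0` commutes with maps of
    -- simplices, which makes `T` natural.
    let T : ∀ k m : ℕ, _ →ₗ[R] ((Fin m → stdSimplex ℝ (Fin (k + 1))) → R) :=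
      fun k => tupleHomotopy (Θ k) (fun _ v => v 0)
    have hTspec : ∀ k m (f : (Fin (m + 1) → stdSimplex ℝ (Fin (k + 1))) → R),
        T k (m + 1) (tupleCoboundary R _ (m + 1) f) + tupleCoboundary R _ m (T k m f) =
          f - tupleSubdivision R tupleBarycenter (m + 1) f := by
      intro k m f
      refine tupleHomotopy_spec (Θ k) (fun _ v => v 0) (fun n f => ?_) (sub_self _) m f
      simp only [Θ, LinearMap.sub_apply, LinearMap.id_apply, map_sub,
        tupleSubdivision_coboundary]
    have hTnat : ∀ {j k : ℕ} (g : Fin (j + 1) → Fin (k + 1)) (m : ℕ)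
        (f : (Fin (m + 1) → stdSimplex ℝ (Fin (k + 1))) → R) v,
        T j m (fun w => f (stdSimplex.map g ∘ w)) v = T k m f (stdSimplex.map g ∘ v) := by
      intro j k g m f v
      refine tupleHomotopy_comp (Θ j) _ (Θ k) _ _ _ (fun n f v => ?_) (fun n v => rfl) m f v
      simp only [Θ, LinearMap.sub_apply, LinearMap.id_apply, Pi.sub_apply]
      rw [tupleSubdivision_comp _ tupleBarycenter _ (map_tupleBarycenter g)]
    -- The primitive will be the series of all `T (S^i θ)`. Since `δθ = 0`, the coboundary of its
    -- `i`-th term is `S^i θ - S^(i+1) θ`, and the series telescopes to `θ`.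
    let term : ∀ i, SingularCochain R X n := fun i σ =>
      T n (n + 1) ((S n)^[i] (θ.onTuples σ)) fun j => stdSimplex.vertex j
    have hzero : ∀ k (σ : SingularSimplex X k), ∃ N, ∀ i ≥ N, (S k)^[i] (θ.onTuples σ) = 0 :=
      fun k σ => SingularCochain.exists_iterate_eq_zero U hU hcov θ hθ σ
    have hterm : ∀ i (σ : SingularSimplex X (n + 1)), singularCoboundary R X n (term i) σ =
        (S (n + 1))^[i] (θ.onTuples σ) (fun j => stdSimplex.vertex j) -
          (S (n + 1))^[i + 1] (θ.onTuples σ) fun j => stdSimplex.vertex j := by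
      intro i σ
      have h1 : singularCoboundary R X n (term i) σ = tupleCoboundary R _ (n + 1)
          (T (n + 1) (n + 1) ((S (n + 1))^[i] (θ.onTuples σ))) fun j => stdSimplex.vertex j := by
        rw [singularCoboundary_apply, tupleCoboundary_apply]
        refine Finset.sum_congr rfl fun j _ => congrArg _ ?_
        change T n (n + 1) ((S n)^[i] (θ.onTuples (σ.reindex j.succAbove))) _ = _
        rw [SingularCochain.onTuples_reindex, tupleSubdivision_iterate_comp _ tupleBarycenter _
          (map_tupleBarycenter j.succAbove), hTnat, map_comp_vertex]
      rw [h1, eq_sub_of_add_eq' (hTspec (n + 1) (n + 1) _), Function.iterate_succ_apply',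
        ← tupleSubdivision_iterate_coboundary, ← SingularCochain.onTuples_coboundary, hδ,
        show SingularCochain.onTuples (0 : SingularCochain R X (n + 2)) σ = 0 from rfl]
      have : ∀ i, (tupleSubdivision R (tupleBarycenter (X := Fin (n + 1 + 1))) (n + 2 + 1))^[i] 0 = 0 :=
        fun i => Function.iterate_fixed (map_zero _) i
      rw [this, map_zero, sub_zero]
      rfl
    choose N hN using fun σ : SingularSimplex X n => hzero n σ
    have htz : ∀ (σ : SingularSimplex X n) i, N σ ≤ i → term i σ = 0 := by
      intro σ i hi
      simp only [term]
      rw [hN σ i hi, map_zero]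
      rfl
    -- The series is finite on each simplex, but its length depends on the simplex.
    refine ⟨fun σ => ∑ i ∈ Finset.range (N σ), term i σ, ?_⟩
    ext σ
    obtain ⟨M, hM⟩ := hzero (n + 1) σ
    -- A common length for all faces of `σ`, also large enough that the last telescoping term `S^Q
    -- θ` vanishes on `σ`.
    let Q := M + ∑ j, N (σ.face j)
    have hQ : ∀ j, N (σ.face j) ≤ Q := fun j =>
      (Finset.single_le_sum (f := fun j => N (σ.face j)) (fun _ _ => Nat.zero_le _)
        (Finset.mem_univ j)).trans (Nat.le_add_left _ _)
    have hsum : ∀ j, ∑ i ∈ Finset.range (N (σ.face j)), term i (σ.face j) =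
        ∑ i ∈ Finset.range Q, term i (σ.face j) := fun j =>
      Finset.sum_subset (Finset.range_subset_range.2 (hQ j)) fun i _ hi =>
        htz _ _ (by simpa using hi)
    calc singularCoboundary R X n (fun σ => ∑ i ∈ Finset.range (N σ), term i σ) σ
        = ∑ j : Fin (n + 2), (-1) ^ (j : ℕ) * ∑ i ∈ Finset.range Q, term i (σ.face j) :=
          by simp only [singularCoboundary_apply, hsum]
      _ = ∑ i ∈ Finset.range Q, singularCoboundary R X n (term i) σ := by
          simp only [Finset.mul_sum, singularCoboundary_apply]
          exact Finset.sum_comm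
      _ = θ σ := by
          simp only [hterm]
          rw [Finset.sum_range_sub', hM Q (Nat.le_add_right _ _)]
          simp [SingularCochain.onTuples_vertex]

end Small

/-! ### Functoriality of cohomology and the cup product -/

section Functoriality

variable {R : Type v} [CommRing R] {X Y Z : Type u} [TopologicalSpace X] [TopologicalSpace Y]
  [TopologicalSpace Z]

theorem SingularCohomology.mk_surjective (n : ℕ) :
    Function.Surjective (SingularCohomology.mk R X n) :=
  Submodule.mkQ_surjective _

theorem SingularCohomology.mk_eq_zero {n : ℕ} (φ : SingularCocycle R X n) :
    SingularCohomology.mk R X n φ = 0 ↔ φ.1 ∈ SingularBoundary R X n :=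
  Submodule.Quotient.mk_eq_zero _

/-- The map of cocycles induced by a continuous map. -/
def SingularCocycle.pullback (R : Type v) [CommRing R] (f : C(X, Y)) (n : ℕ)
    (φ : SingularCocycle R Y n) : SingularCocycle R X n :=
  ⟨SingularCochain.pullback R f n φ.1, by
    rw [LinearMap.mem_ker, singularCoboundary_pullback, LinearMap.mem_ker.1 φ.2, map_zero]⟩

theorem SingularCohomology.pullback_mk (f : C(X, Y)) (n : ℕ) (φ : SingularCocycle R Y n) :
    SingularCohomology.pullback R f n (SingularCohomology.mk R Y n φ) =
      SingularCohomology.mk R X n (SingularCocycle.pullback R f n φ) := rfl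

theorem SingularCohomology.pullback_comp (g : C(Y, Z)) (f : C(X, Y)) (n : ℕ)
    (x : SingularCohomology R Z n) :
    SingularCohomology.pullback R (g.comp f) n x =
      SingularCohomology.pullback R f n (SingularCohomology.pullback R g n x) := by
  obtain ⟨φ, rfl⟩ := SingularCohomology.mk_surjective n x
  rfl

theorem SingularCohomology.pullback_id (n : ℕ) (x : SingularCohomology R X n) :
    SingularCohomology.pullback R (ContinuousMap.id X) n x = x := by
  obtain ⟨φ, rfl⟩ := SingularCohomology.mk_surjective n x
  rfl

theorem SingularCohomology.pullback_cup (f : C(X, Y)) (n m : ℕ) (x : SingularCohomology R Y n)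
    (y : SingularCohomology R Y m) :
    SingularCohomology.pullback R f (n + m) (SingularCohomology.cup R Y n m x y) =
      SingularCohomology.cup R X n m (SingularCohomology.pullback R f n x)
        (SingularCohomology.pullback R f m y) := by
  obtain ⟨φ, rfl⟩ := SingularCohomology.mk_surjective n x
  obtain ⟨ψ, rfl⟩ := SingularCohomology.mk_surjective m y
  rfl

theorem TotalCohomology.pullback_of (f : C(X, Y)) (n : ℕ) (x : SingularCohomology R Y n) :
    TotalCohomology.pullback R f (DirectSum.of (SingularCohomology R Y) n x) =
      DirectSum.of (SingularCohomology R X) n (SingularCohomology.pullback R f n x) :=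
  DirectSum.lmap_lof _ _ _

theorem TotalCohomology.pullback_comp (g : C(Y, Z)) (f : C(X, Y)) (ξ : TotalCohomology R Z) :
    TotalCohomology.pullback R (g.comp f) ξ =
      TotalCohomology.pullback R f (TotalCohomology.pullback R g ξ) := by
  refine DFinsupp.ext fun n => ?_
  exact SingularCohomology.pullback_comp g f n (ξ n)

theorem TotalCohomology.pullback_id (ξ : TotalCohomology R X) :
    TotalCohomology.pullback R (ContinuousMap.id X) ξ = ξ := by
  refine DFinsupp.ext fun n => ?_
  exact SingularCohomology.pullback_id n (ξ n)

theorem TotalCohomology.of_mul_of (n m : ℕ) (x : SingularCohomology R X n)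
    (y : SingularCohomology R X m) :
    (DirectSum.of (SingularCohomology R X) n x * DirectSum.of (SingularCohomology R X) m y :
      TotalCohomology R X) =
      DirectSum.of (SingularCohomology R X) (n + m) (SingularCohomology.cup R X n m x y) :=
  DirectSum.of_mul_of x y

theorem TotalCohomology.pullback_mul (f : C(X, Y)) (ξ η : TotalCohomology R Y) :
    TotalCohomology.pullback R f (ξ * η) =
      TotalCohomology.pullback R f ξ * TotalCohomology.pullback R f η := by
  induction ξ using DirectSum.induction_on with
  | zero => simp
  | add ξ ξ' h h' => rw [add_mul, map_add, map_add, add_mul, h, h']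
  | of n x =>
    induction η using DirectSum.induction_on with
    | zero => simp
    | add ξ ξ' h h' => rw [mul_add, map_add, map_add, mul_add, h, h']
    | of m y =>
      simp only [pullback_of, of_mul_of, SingularCohomology.pullback_cup]

/-- The inclusion of a subspace. -/
def subspaceInclusion (A : Set X) : C(A, X) := ⟨Subtype.val, continuous_subtype_val⟩

/-- A class that restricts to zero on `A` is represented by a cocycle that vanishes on `A`. -/
theorem SingularCohomology.exists_mk_eq_of_pullback_eq_zero (A : Set X) {n : ℕ}
    (x : SingularCohomology R X n)
    (hx : SingularCohomology.pullback R (subspaceInclusion A) n x = 0) :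
    ∃ φ : SingularCocycle R X n, SingularCohomology.mk R X n φ = x ∧
      ∀ σ : SingularSimplex X n, (∀ y, σ y ∈ A) → φ.1 σ = 0 := by
  classical
  obtain ⟨φ, rfl⟩ := SingularCohomology.mk_surjective n x
  rw [pullback_mk, mk_eq_zero] at hx
  have lift : ∀ {n : ℕ} (σ : SingularSimplex X n) (h : ∀ y, σ y ∈ A),
      ∃ τ : SingularSimplex A n, (subspaceInclusion A).comp τ = σ := fun σ h =>
    ⟨⟨fun y => ⟨σ y, h y⟩, σ.continuous.subtype_mk _⟩, rfl⟩
  cases n with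
  | zero =>
    refine ⟨φ, rfl, fun σ hσ => ?_⟩
    obtain ⟨τ, rfl⟩ := lift σ hσ
    exact congrFun hx τ
  | succ n =>
    obtain ⟨α, hα⟩ := hx
    -- The primitive on `A`, extended by zero. Subtracting its coboundary keeps the class and kills
    -- the values on simplices in `A`.
    let β : SingularCochain R X n := fun σ =>
      if h : ∀ y, σ y ∈ A then α ⟨fun y => ⟨σ y, h y⟩, σ.continuous.subtype_mk _⟩ else 0
    have hβ : ∀ τ : SingularSimplex A n, β ((subspaceInclusion A).comp τ) = α τ := fun τ =>
      dif_pos (fun y => (τ y).2)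
    have hmem : singularCoboundary R X n β ∈ SingularBoundary R X (n + 1) := ⟨β, rfl⟩
    have hker : singularCoboundary R X n β ∈ SingularCocycle R X (n + 1) := by
      rw [LinearMap.mem_ker]
      ext σ
      -- For singular cochains `δδ = 0` is the identity on tuples, read off at the vertices.
      have := congrFun (tupleCoboundary_tupleCoboundary (n + 1) (β.onTuples σ))
        fun i => stdSimplex.vertex i
      rw [← SingularCochain.onTuples_coboundary, ← SingularCochain.onTuples_coboundary,
        SingularCochain.onTuples_vertex] at this
      exact this
    refine ⟨φ - ⟨_, hker⟩, ?_, fun σ hσ => ?_⟩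
    · rw [map_sub, sub_eq_self, mk_eq_zero]
      exact hmem
    · obtain ⟨τ, rfl⟩ := lift σ hσ
      have h1 := congrFun hα τ
      have h2 : singularCoboundary R X n β ((subspaceInclusion A).comp τ) =
          singularCoboundary R A n α τ := by
        rw [singularCoboundary_apply, singularCoboundary_apply]
        exact Finset.sum_congr rfl fun i _ => congrArg _ (hβ (τ.face i))
      change φ.1 _ - singularCoboundary R X n β _ = 0
      rw [h2, h1]
      exact sub_self _

/-- The cup product of classes that vanish on the members of an open cover is zero. -/
theorem SingularCohomology.cup_eq_zero (A A' : Set X) (hA : IsOpen A) (hA' : IsOpen A')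
    (hcov : A ∪ A' = Set.univ) {n m : ℕ} (x : SingularCohomology R X n)
    (y : SingularCohomology R X m)
    (hx : SingularCohomology.pullback R (subspaceInclusion A) n x = 0)
    (hy : SingularCohomology.pullback R (subspaceInclusion A') m y = 0) :
    SingularCohomology.cup R X n m x y = 0 := by
  obtain ⟨φ, rfl, hφ⟩ := exists_mk_eq_of_pullback_eq_zero A x hx
  obtain ⟨ψ, rfl, hψ⟩ := exists_mk_eq_of_pullback_eq_zero A' y hy
  rw [cup_mk, mk_eq_zero]
  -- On a simplex inside `A` the front factor vanishes, on one inside `A'` the back factor.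
  -- Simplices inside neither are taken care of by subdivision.
  refine SingularCochain.mem_boundary_of_small (fun b : Bool => bif b then A else A')
    (by simp [hA, hA']) (by rw [← hcov, Set.union_eq_iUnion]) _
    (LinearMap.mem_ker.1 (SingularCocycle.cup R X rfl φ ψ).2) ?_
  rintro σ ⟨b, hb⟩
  change φ.1 _ * ψ.1 _ = 0
  cases b with
  | true => rw [hφ _ fun y => hb _, zero_mul]
  | false => rw [hψ _ fun y => hb _, mul_zero]

theorem TotalCohomology.mul_eq_zero (A A' : Set X) (hA : IsOpen A) (hA' : IsOpen A')
    (hcov : A ∪ A' = Set.univ) (ξ η : TotalCohomology R X)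
    (hξ : TotalCohomology.pullback R (subspaceInclusion A) ξ = 0)
    (hη : TotalCohomology.pullback R (subspaceInclusion A') η = 0) : ξ * η = 0 := by
  classical
  rw [← DirectSum.sum_support_of ξ, ← DirectSum.sum_support_of η, Finset.sum_mul]
  refine Finset.sum_eq_zero fun n _ => ?_
  rw [Finset.mul_sum]
  refine Finset.sum_eq_zero fun m _ => ?_
  rw [of_mul_of, SingularCohomology.cup_eq_zero A A' hA hA' hcov, map_zero]
  · exact DFunLike.congr_fun hξ n
  · exact DFunLike.congr_fun hη m

end Functoriality

/-! ### Genus and weight -/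

section Genus

variable {E B X : Type u} [TopologicalSpace E] [TopologicalSpace B] [TopologicalSpace X]

theorem hasSectionOver_empty (p : C(E, B)) : HasSectionOver p ∅ :=
  ⟨⟨fun x => x.2.elim, continuous_of_const fun x => x.2.elim⟩, fun x => x.2.elim⟩

theorem HasSectionalCover.mono {p : C(E, B)} {k l : ℕ} (h : HasSectionalCover p k) (hkl : k ≤ l) :
    HasSectionalCover p l := by
  obtain ⟨U, hU, hcov, hs⟩ := h
  refine ⟨fun i => if h : i.1 < k then U ⟨i, h⟩ else ∅, fun i => ?_, ?_, fun i => ?_⟩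
  · dsimp only
    split_ifs
    exacts [hU _, isOpen_empty]
  · refine Set.eq_univ_of_forall fun x => ?_
    obtain ⟨i, hi⟩ := Set.mem_iUnion.1 (hcov ▸ Set.mem_univ x)
    exact Set.mem_iUnion.2 ⟨⟨i, i.2.trans_le hkl⟩, by simpa using hi⟩
  · dsimp only
    split_ifs
    exacts [hs _, hasSectionOver_empty p]

/-- Covers can be padded with empty sets, so the possible sizes are upward closed and a finite
infimum is attained. -/
theorem schwarzGenus_le_iff {p : C(E, B)} {k : ℕ} :
    schwarzGenus p ≤ k ↔ HasSectionalCover p k := by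
  refine ⟨fun h => ?_, fun h => iInf₂_le k h⟩
  by_contra hk
  have : ((k + 1 : ℕ) : ℕ∞) ≤ schwarzGenus p := le_iInf₂ fun m hm => by
    by_contra! hlt
    exact hk (hm.mono (by exact_mod_cast Order.lt_add_one_iff.1 (by exact_mod_cast hlt)))
  have h2 := this.trans h
  norm_cast at h2
  omega

/-- Replaces the pullback space by partial lifts of `f`, with which all later genus estimates are
made. -/
theorem hasSectionOver_pullbackMap_iff {p : C(E, B)} {f : C(X, B)} {U : Set X} :
    HasSectionOver (pullbackMap f p) U ↔ ∃ e : C(U, E), ∀ x : U, p (e x) = f x := by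
  constructor
  · rintro ⟨s, hs⟩
    refine ⟨⟨fun x => (s x).1.2, by fun_prop⟩, fun x => ?_⟩
    rw [← hs x]
    exact (s x).2.symm
  · rintro ⟨e, he⟩
    exact ⟨⟨fun x => ⟨(x.1, e x), (he x).symm⟩, by fun_prop⟩, fun x => rfl⟩

theorem hasSectionalCover_pullbackMap_iff {p : C(E, B)} {f : C(X, B)} {k : ℕ} :
    HasSectionalCover (pullbackMap f p) k ↔ ∃ U : Fin k → Set X, (∀ i, IsOpen (U i)) ∧
      (⋃ i, U i) = Set.univ ∧ ∀ i, ∃ e : C(U i, E), ∀ x : U i, p (e x) = f x := by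
  simp only [HasSectionalCover, hasSectionOver_pullbackMap_iff]

theorem schwarzGenus_pullbackMap_id_le (p : C(E, B)) :
    schwarzGenus (pullbackMap (ContinuousMap.id B) p) ≤ schwarzGenus p := by
  refine le_iInf₂ fun k hk => ?_
  rw [schwarzGenus_le_iff, hasSectionalCover_pullbackMap_iff]
  exact hk

theorem schwarzGenus_pullbackMap_le_one_iff (p : C(E, B)) (f : C(X, B)) :
    schwarzGenus (pullbackMap f p) ≤ 1 ↔ ∃ e : C(X, E), p.comp e = f := by
  rw [show (1 : ℕ∞) = ((1 : ℕ) : ℕ∞) from rfl, schwarzGenus_le_iff,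
    hasSectionalCover_pullbackMap_iff]
  constructor
  · rintro ⟨U, -, hcov, hs⟩
    obtain ⟨e, he⟩ := hs 0
    have hU : ∀ x, x ∈ U 0 := fun x => by
      obtain ⟨i, hi⟩ := Set.mem_iUnion.1 (hcov ▸ Set.mem_univ x)
      rwa [Subsingleton.elim i 0] at hi
    exact ⟨e.comp ⟨fun x => ⟨x, hU x⟩, by fun_prop⟩, ContinuousMap.ext fun x => he ⟨x, hU x⟩⟩
  · rintro ⟨e, rfl⟩
    exact ⟨fun _ => Set.univ, fun _ => isOpen_univ, Set.iUnion_const _, fun _ =>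
      ⟨e.comp ⟨Subtype.val, continuous_subtype_val⟩, fun x => rfl⟩⟩

variable {R : Type v} [CommRing R]

theorem VanishesUpToGenus.mono {p : C(E, B)} {ξ : TotalCohomology R B} {k l : ℕ}
    (h : VanishesUpToGenus p ξ l) (hkl : k ≤ l) : VanishesUpToGenus p ξ k :=
  fun X _ f hf => h X f (hf.trans (by exact_mod_cast hkl))

theorem TotalCohomology.eq_zero_of_isEmpty [IsEmpty X] (ξ : TotalCohomology R X) : ξ = 0 := by
  refine DFinsupp.ext fun n => ?_
  obtain ⟨φ, hφ⟩ := SingularCohomology.mk_surjective n (ξ n)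
  rw [← hφ]
  refine (SingularCohomology.mk_eq_zero φ).2 ?_
  rw [show φ.1 = 0 from funext fun σ => isEmptyElim (σ (stdSimplex.vertex 0))]
  exact Submodule.zero_mem _

/-- Only the empty space has genus zero. Hence the supremum that defines the weight is never taken
over the empty set. -/
theorem vanishesUpToGenus_zero (p : C(E, B)) (ξ : TotalCohomology R B) :
    VanishesUpToGenus p ξ 0 := by
  intro X _ f hf
  obtain ⟨U, -, hcov, -⟩ := schwarzGenus_le_iff.1 hf
  have : IsEmpty X := ⟨fun x => by
    obtain ⟨i, -⟩ := Set.mem_iUnion.1 (hcov ▸ Set.mem_univ x)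
    exact i.elim0⟩
  exact TotalCohomology.eq_zero_of_isEmpty _

/-- The admissible `k` are downward closed and include `0`, so a finite lower bound for the supremum
is itself admissible. -/
theorem le_sectionalWeight_iff {p : C(E, B)} {ξ : TotalCohomology R B} {k : ℕ} :
    (k : ℕ∞) ≤ sectionalWeight p ξ ↔ VanishesUpToGenus p ξ k := by
  refine ⟨fun h => ?_, fun h => le_iSup₂ (f := fun (k : ℕ) _ => (k : ℕ∞)) k h⟩
  by_contra hk
  obtain _ | k := k
  · exact hk (vanishesUpToGenus_zero p ξ)
  have : sectionalWeight p ξ ≤ (k : ℕ) := iSup₂_le fun m hm => by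
    by_contra! hlt
    exact hk (hm.mono (by exact_mod_cast hlt))
  have h2 := h.trans this
  norm_cast at h2
  omega

theorem one_le_sectionalWeight_iff (p : C(E, B)) (ξ : TotalCohomology R B) :
    1 ≤ sectionalWeight p ξ ↔ TotalCohomology.pullback R p ξ = 0 := by
  rw [show (1 : ℕ∞) = ((1 : ℕ) : ℕ∞) from rfl, le_sectionalWeight_iff]
  constructor
  · intro h
    -- The map `p` lifts through itself by the identity of `E`, so it is a test map of genus at most
    -- one.
    exact h E p ((schwarzGenus_pullbackMap_le_one_iff p p).2 ⟨ContinuousMap.id E, rfl⟩)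
  · intro h X _ f hf
    obtain ⟨e, rfl⟩ := (schwarzGenus_pullbackMap_le_one_iff p f).1 hf
    rw [TotalCohomology.pullback_comp, h, map_zero]

/-- A union of part of a sectional cover. -/
theorem schwarzGenus_pullbackMap_iUnion_le (p : C(E, B)) (f : C(X, B)) {k : ℕ}
    (U : Fin k → Set X) (hU : ∀ i, IsOpen (U i))
    (hs : ∀ i, ∃ e : C(U i, E), ∀ x : U i, p (e x) = f x) :
    schwarzGenus (pullbackMap (f.comp (subspaceInclusion (⋃ i, U i))) p) ≤ k := by
  rw [schwarzGenus_le_iff, hasSectionalCover_pullbackMap_iff]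
  refine ⟨fun i => Subtype.val ⁻¹' U i, fun i => (hU i).preimage continuous_subtype_val, ?_,
    fun i => ?_⟩
  · refine Set.eq_univ_of_forall fun x => ?_
    obtain ⟨i, hi⟩ := Set.mem_iUnion.1 x.2
    exact Set.mem_iUnion.2 ⟨i, hi⟩
  · obtain ⟨e, he⟩ := hs i
    exact ⟨e.comp ⟨fun x => ⟨x.1.1, x.2⟩, by fun_prop⟩, fun x => he ⟨x.1.1, x.2⟩⟩

/-- The first `k` sets of the cover have a union on which `ξ` dies, the last `l` a union on which
`η` dies; the two unions cover `X`. -/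
theorem VanishesUpToGenus.mul {p : C(E, B)} {ξ η : TotalCohomology R B} {k l : ℕ}
    (hξ : VanishesUpToGenus p ξ k) (hη : VanishesUpToGenus p η l) :
    VanishesUpToGenus p (ξ * η) (k + l) := by
  intro X _ f hf
  rw [schwarzGenus_le_iff, hasSectionalCover_pullbackMap_iff] at hf
  obtain ⟨U, hU, hcov, hs⟩ := hf
  rw [TotalCohomology.pullback_mul]
  refine TotalCohomology.mul_eq_zero (⋃ i : Fin k, U (Fin.castAdd l i))
    (⋃ i : Fin l, U (Fin.natAdd k i)) (isOpen_iUnion fun i => hU _) (isOpen_iUnion fun i => hU _)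
    ?_ _ _ ?_ ?_
  · refine Set.eq_univ_of_forall fun x => ?_
    obtain ⟨i, hi⟩ := Set.mem_iUnion.1 (hcov ▸ Set.mem_univ x)
    induction i using Fin.addCases with
    | left i => exact Or.inl (Set.mem_iUnion.2 ⟨i, hi⟩)
    | right i => exact Or.inr (Set.mem_iUnion.2 ⟨i, hi⟩)
  · rw [← TotalCohomology.pullback_comp]
    exact hξ _ _ (schwarzGenus_pullbackMap_iUnion_le p f _ (fun _ => hU _) fun _ => hs _)
  · rw [← TotalCohomology.pullback_comp]
    exact hη _ _ (schwarzGenus_pullbackMap_iUnion_le p f _ (fun _ => hU _) fun _ => hs _)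

theorem sectionalWeight_add_le_mul (p : C(E, B)) (ξ η : TotalCohomology R B) :
    sectionalWeight p ξ + sectionalWeight p η ≤ sectionalWeight p (ξ * η) :=
  ENat.biSup_add_biSup_le' ⟨0, vanishesUpToGenus_zero p ξ⟩ ⟨0, vanishesUpToGenus_zero p η⟩
    fun k hk l hl => by
      rw [← Nat.cast_add]
      exact le_sectionalWeight_iff.2 (hk.mul hl)

theorem sum_sectionalWeight_le_prod (p : C(E, B)) (l : ℕ) (ξ : Fin l → TotalCohomology R B) :
    ∑ i, sectionalWeight p (ξ i) ≤ sectionalWeight p (List.ofFn ξ).prod := by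
  induction l with
  | zero => simp
  | succ l ih =>
    rw [Fin.sum_univ_succ, List.ofFn_succ, List.prod_cons]
    exact (add_le_add_right (ih _) _).trans (sectionalWeight_add_le_mul p _ _)

/-- For finite genus the identity of `B` is a test map and forces `ξ = 0`. For infinite genus the
claim is that the weight is finite, and `hfin` supplies a test map that witnesses it. -/
theorem sectionalWeight_lt_schwarzGenus (p : C(E, B)) (ξ : TotalCohomology R B) (hξ : ξ ≠ 0)
    (hfin : ∃ (X : Type u) (_ : TopologicalSpace X) (f : C(X, B)) (k : ℕ),
      schwarzGenus (pullbackMap f p) ≤ k ∧ TotalCohomology.pullback R f ξ ≠ 0) :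
    sectionalWeight p ξ < schwarzGenus p := by
  by_contra! h
  cases hg : schwarzGenus p with
  | top =>
    obtain ⟨X, _, f, k, hk, hf⟩ := hfin
    refine hf (le_sectionalWeight_iff.1 (le_trans ?_ h) X f hk)
    rw [hg]
    exact le_top
  | coe k =>
    rw [hg] at h
    apply hξ
    rw [← TotalCohomology.pullback_id ξ]
    exact le_sectionalWeight_iff.1 h B _ ((schwarzGenus_pullbackMap_id_le p).trans hg.le)

end Genus

/-! ### Natural self-homotopies of the standard simplices -/

section Prism

variable {R : Type v} [CommRing R] {X : Type u} [TopologicalSpace X]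

/-- The function on tuples of points of a prism that is induced by a singular cochain. -/
def SingularCochain.onPrism {n k : ℕ} (φ : SingularCochain R X n)
    (τ : C(stdSimplex ℝ (Fin (k + 1)) × stdSimplex ℝ (Fin 2), X)) :
    (Fin (n + 1) → stdSimplex ℝ (Fin (k + 1)) × stdSimplex ℝ (Fin 2)) → R :=
  fun v => φ (τ.comp ((affineSimplex (Prod.fst ∘ v)).prodMk (affineSimplex (Prod.snd ∘ v))))

theorem SingularCochain.onPrism_coboundary {n k : ℕ} (φ : SingularCochain R X n)
    (τ : C(stdSimplex ℝ (Fin (k + 1)) × stdSimplex ℝ (Fin 2), X)) :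
    SingularCochain.onPrism (singularCoboundary R X n φ) τ =
      tupleCoboundary R _ (n + 1) (φ.onPrism τ) := by
  ext v
  rw [SingularCochain.onPrism, singularCoboundary_apply, tupleCoboundary_apply]
  refine Finset.sum_congr rfl fun i _ => congrArg _ (congrArg φ ?_)
  ext y
  exact congrArg τ (Prod.ext (affineSimplex_map _ i.succAbove y)
    (affineSimplex_map _ i.succAbove y))

/-- A cocycle is a coboundary if it becomes one after composition with the end of a natural
homotopy of the standard simplices that starts at the identity. -/
theorem SingularCochain.mem_boundary_of_homotopy
    (D : ∀ k, C(stdSimplex ℝ (Fin (k + 1)) × stdSimplex ℝ (Fin 2), stdSimplex ℝ (Fin (k + 1))))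
    (hD : ∀ k (i : Fin (k + 2)) x s,
      D (k + 1) (stdSimplex.map i.succAbove x, s) = stdSimplex.map i.succAbove (D k (x, s)))
    (hD0 : ∀ k x, D k (x, stdSimplex.vertex 0) = x) {n : ℕ} (φ : SingularCochain R X n)
    (hφ : singularCoboundary R X n φ = 0)
    (h : (fun σ => φ (σ.comp ((D n).comp ((ContinuousMap.id _).prodMk
      (ContinuousMap.const _ (stdSimplex.vertex 1))))) : SingularCochain R X n) ∈
      SingularBoundary R X n) : φ ∈ SingularBoundary R X n := by
  let Θ : ∀ k m : ℕ, ((Fin m → stdSimplex ℝ (Fin (k + 1)) × stdSimplex ℝ (Fin 2)) → R) →ₗ[R]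
      ((Fin m → stdSimplex ℝ (Fin (k + 1))) → R) := fun k m =>
    LinearMap.funLeft R R (fun v i => (v i, stdSimplex.vertex 1)) -
      LinearMap.funLeft R R (fun v i => (v i, stdSimplex.vertex 0))
  -- The prism operator: a natural homotopy between restriction to the two ends of the prism.
  let Q : ∀ k m : ℕ, ((Fin (m + 1) → stdSimplex ℝ (Fin (k + 1)) × stdSimplex ℝ (Fin 2)) → R)
      →ₗ[R] ((Fin m → stdSimplex ℝ (Fin (k + 1))) → R) := fun k =>
    tupleHomotopy (Θ k) fun _ v => (v 0, stdSimplex.vertex 0)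
  have hspec : ∀ k m f, Q k (m + 1) (tupleCoboundary R _ (m + 1) f) +
      tupleCoboundary R _ m (Q k m f) = Θ k (m + 1) f := by
    intro k m f
    refine tupleHomotopy_spec (Θ k) _ (fun n f => ?_) ?_ m f
    · simp only [Θ, LinearMap.sub_apply, map_sub]
      rfl
    · refine LinearMap.ext fun f => funext fun v => ?_
      change f _ - f _ = 0
      rw [sub_eq_zero]
      exact congrArg f (Subsingleton.elim _ _)
  have hnat : ∀ {j k : ℕ} (g : Fin (j + 1) → Fin (k + 1)) (m : ℕ)
      (f : (Fin (m + 1) → stdSimplex ℝ (Fin (k + 1)) × stdSimplex ℝ (Fin 2)) → R) v,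
      Q j m (fun w => f (Prod.map (stdSimplex.map g) id ∘ w)) v =
        Q k m f (stdSimplex.map g ∘ v) := by
    intro j k g m f v
    refine tupleHomotopy_comp (Θ j) _ (Θ k) _ _ _ (fun n f v => rfl) (fun n v => rfl) m f v
  let F : SingularSimplex X n →
      (Fin (n + 1) → stdSimplex ℝ (Fin (n + 1)) × stdSimplex ℝ (Fin 2)) → R :=
    fun σ => φ.onPrism (σ.comp (D n))
  have hF : ∀ σ, tupleCoboundary R _ (n + 1) (F σ) = 0 := by
    intro σ
    rw [← SingularCochain.onPrism_coboundary, hφ]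
    rfl
  have hend : ∀ σ : SingularSimplex X n,
      φ σ = φ (σ.comp ((D n).comp ((ContinuousMap.id _).prodMk
        (ContinuousMap.const _ (stdSimplex.vertex 1))))) -
        tupleCoboundary R _ n (Q n n (F σ)) fun i => stdSimplex.vertex i := by
    intro σ
    have h1 := congrFun (hspec n n (F σ)) fun i => stdSimplex.vertex i
    rw [hF, map_zero, zero_add] at h1
    rw [h1]
    have e1 : F σ (fun i => (stdSimplex.vertex i, stdSimplex.vertex 1)) =
        φ (σ.comp ((D n).comp ((ContinuousMap.id _).prodMk
        (ContinuousMap.const _ (stdSimplex.vertex 1))))) := by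
      refine congrArg φ (ContinuousMap.ext fun y => ?_)
      exact congrArg (fun z => σ (D n z))
        (Prod.ext (affineSimplex_vertex y) (affineSimplex_const _ y))
    have e0 : F σ (fun i => (stdSimplex.vertex i, stdSimplex.vertex 0)) = φ σ := by
      refine congrArg φ (ContinuousMap.ext fun y => ?_)
      exact (congrArg (fun z => σ (D n z)) (Prod.ext (affineSimplex_vertex y)
        (affineSimplex_const (stdSimplex.vertex 0) y))).trans (congrArg σ (hD0 n y))
    change _ = _ - (F σ (fun i => (stdSimplex.vertex i, stdSimplex.vertex 1)) -
      F σ (fun i => (stdSimplex.vertex i, stdSimplex.vertex 0)))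
    rw [e1, e0, sub_sub_cancel]
  rw [show φ = _ - _ from funext hend]
  -- The correction term is the coboundary of `Q` evaluated at the vertices, because `D` and `Q`
  -- commute with faces. In degree zero `Q` is zero.
  refine Submodule.sub_mem _ h ?_
  cases n with
  | zero =>
    refine (funext fun σ => ?_ : _ = (0 : SingularCochain R X 0))
    change tupleCoboundary R _ 0 0 _ = 0
    rw [map_zero]
    rfl
  | succ n =>
    refine ⟨fun τ => Q n (n + 1) (φ.onPrism (τ.comp (D n))) fun i => stdSimplex.vertex i, ?_⟩
    ext σ
    rw [singularCoboundary_apply, tupleCoboundary_apply]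
    refine Finset.sum_congr rfl fun i _ => congrArg _ ?_
    rw [← map_comp_vertex, ← hnat]
    refine congrFun (congrArg (Q n (n + 1)) (funext fun v => ?_)) _
    refine congrArg φ (ContinuousMap.ext fun y => ?_)
    change σ (stdSimplex.map i.succAbove (D n _)) = σ (D (n + 1) _)
    rw [← hD]
    congr 2
    exact Prod.ext (map_affineSimplex _ _ _) rfl

end Prism

/-! ### Truncation of barycentric coordinates -/

section Truncation

theorem stdSimplex.map_apply_of_injective {m n : ℕ} {g : Fin m → Fin n}
    (hg : Function.Injective g) (x : stdSimplex ℝ (Fin m)) (i : Fin m) :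
    stdSimplex.map g x (g i) = x i := by
  classical
  rw [stdSimplex.map_coe, FunOnFinite.linearMap_apply_apply]
  rw [show ({a | g a = g i} : Finset (Fin m)) = {i} by ext; simp [hg.eq_iff]]
  simp

theorem stdSimplex.map_apply_of_notMem {m n : ℕ} {g : Fin m → Fin n}
    (x : stdSimplex ℝ (Fin m)) {j : Fin n} (hj : j ∉ Set.range g) :
    stdSimplex.map g x j = 0 := by
  classical
  rw [stdSimplex.map_coe, FunOnFinite.linearMap_apply_apply]
  refine Finset.sum_eq_zero fun i hi => ?_
  exact (hj ⟨i, (Finset.mem_filter.1 hi).2⟩).elim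

/-- Half of the sum of the squares of the barycentric coordinates: a positive number that is less
than the largest coordinate. -/
def truncationLevel {n : ℕ} (x : stdSimplex ℝ (Fin n)) : ℝ := (∑ i, x i ^ 2) / 2

theorem continuous_stdSimplex_apply {n : ℕ} (i : Fin n) :
    Continuous fun x : stdSimplex ℝ (Fin n) => x i :=
  (continuous_apply i).comp continuous_subtype_val

theorem continuous_truncationLevel {n : ℕ} :
    Continuous (truncationLevel : stdSimplex ℝ (Fin n) → ℝ) :=
  (continuous_finsetSum _ fun i _ => (continuous_stdSimplex_apply i).pow 2).div_const 2

theorem truncationLevel_pos {n : ℕ} (x : stdSimplex ℝ (Fin n)) : 0 < truncationLevel x := by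
  have : ∃ i, x i ≠ 0 := by
    by_contra! h
    have := stdSimplex.sum_eq_one x
    simp [h] at this
  obtain ⟨i, hi⟩ := this
  have : 0 < ∑ i, x i ^ 2 :=
    Finset.sum_pos' (fun i _ => sq_nonneg _) ⟨i, Finset.mem_univ i, by positivity⟩
  exact half_pos this

/-- The sum of squares is the mean of the coordinates with the coordinates as weights, so it is at
most the largest one; half of it is strictly less. -/
theorem exists_truncationLevel_lt {n : ℕ} (x : stdSimplex ℝ (Fin n)) :
    ∃ i, truncationLevel x < x i := by
  by_contra! h
  have h1 : ∑ i, x i ^ 2 ≤ ∑ i, x i * truncationLevel x :=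
    Finset.sum_le_sum fun i _ => by
      rw [sq]
      exact mul_le_mul_of_nonneg_left (h i) (stdSimplex.zero_le x i)
  rw [← Finset.sum_mul, stdSimplex.sum_eq_one, one_mul] at h1
  have h2 := truncationLevel_pos x
  have h3 : truncationLevel x = (∑ i, x i ^ 2) / 2 := rfl
  linarith

/-- Zero coordinates add nothing to a sum of squares. This compatibility with faces makes truncation
natural. -/
theorem truncationLevel_map {m n : ℕ} {g : Fin m → Fin n} (hg : Function.Injective g)
    (x : stdSimplex ℝ (Fin m)) : truncationLevel (stdSimplex.map g x) = truncationLevel x := by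
  refine congrArg (· / 2) (Fintype.sum_of_injective g hg _ _ (fun j hj => ?_) fun i => ?_).symm
  · rw [stdSimplex.map_apply_of_notMem x hj]
    norm_num
  · rw [stdSimplex.map_apply_of_injective hg]

/-- The coordinates of `x`, diminished by `t` times the truncation level. -/
def truncatedCoord {n : ℕ} (x : stdSimplex ℝ (Fin n)) (t : ℝ) (i : Fin n) : ℝ :=
  max (x i - t * truncationLevel x) 0

/-- A coordinate above the truncation level survives up to `t = 1`, so rescaling is possible
throughout the homotopy. -/
theorem sum_truncatedCoord_pos {n : ℕ} (x : stdSimplex ℝ (Fin n)) {t : ℝ} (ht : t ≤ 1) :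
    0 < ∑ i, truncatedCoord x t i := by
  obtain ⟨i, hi⟩ := exists_truncationLevel_lt x
  refine Finset.sum_pos' (fun _ _ => le_max_right _ _) ⟨i, Finset.mem_univ i, ?_⟩
  refine lt_max_of_lt_left ?_
  nlinarith [truncationLevel_pos x]

theorem truncatedCoord_map {m n : ℕ} {g : Fin m → Fin n} (hg : Function.Injective g)
    (x : stdSimplex ℝ (Fin m)) (t : ℝ) (i : Fin m) :
    truncatedCoord (stdSimplex.map g x) t (g i) = truncatedCoord x t i := by
  rw [truncatedCoord, truncatedCoord, truncationLevel_map hg, stdSimplex.map_apply_of_injective hg]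

theorem truncatedCoord_map_of_notMem {m n : ℕ} {g : Fin m → Fin n} (hg : Function.Injective g)
    (x : stdSimplex ℝ (Fin m)) {t : ℝ} (ht : 0 ≤ t) {j : Fin n} (hj : j ∉ Set.range g) :
    truncatedCoord (stdSimplex.map g x) t j = 0 := by
  rw [truncatedCoord, truncationLevel_map hg, stdSimplex.map_apply_of_notMem x hj]
  exact max_eq_right (by nlinarith [truncationLevel_pos x])

theorem sum_truncatedCoord_map {m n : ℕ} {g : Fin m → Fin n} (hg : Function.Injective g)
    (x : stdSimplex ℝ (Fin m)) {t : ℝ} (ht : 0 ≤ t) :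
    ∑ j, truncatedCoord (stdSimplex.map g x) t j = ∑ i, truncatedCoord x t i :=
  (Fintype.sum_of_injective g hg _ _ (fun _ hj => truncatedCoord_map_of_notMem hg x ht hj)
    fun i => (truncatedCoord_map hg x t i).symm).symm

/-- The homotopy of the standard simplex that removes small coordinates and rescales. -/
def truncation (n : ℕ) :
    C(stdSimplex ℝ (Fin n) × stdSimplex ℝ (Fin 2), stdSimplex ℝ (Fin n)) where
  toFun z := ⟨fun i => truncatedCoord z.1 (z.2 1) i / ∑ j, truncatedCoord z.1 (z.2 1) j,
    fun i => div_nonneg (le_max_right _ _)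
      (sum_truncatedCoord_pos z.1 (stdSimplex.le_one z.2 1)).le,
    by rw [← Finset.sum_div,
      div_self (sum_truncatedCoord_pos z.1 (stdSimplex.le_one z.2 1)).ne']⟩
  continuous_toFun := by
    have hc : ∀ i, Continuous fun z : stdSimplex ℝ (Fin n) × stdSimplex ℝ (Fin 2) =>
        truncatedCoord z.1 (z.2 1) i := fun i =>
      (((continuous_stdSimplex_apply i).comp continuous_fst).sub
        (((continuous_stdSimplex_apply 1).comp continuous_snd).mul
          (continuous_truncationLevel.comp continuous_fst))).max continuous_const
    exact Continuous.subtype_mk (continuous_pi fun i => (hc i).div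
      (continuous_finsetSum _ fun j _ => hc j) fun z =>
        (sum_truncatedCoord_pos z.1 (stdSimplex.le_one z.2 1)).ne') _

theorem truncation_apply {n : ℕ} (x : stdSimplex ℝ (Fin n)) (s : stdSimplex ℝ (Fin 2))
    (i : Fin n) :
    truncation n (x, s) i = truncatedCoord x (s 1) i / ∑ j, truncatedCoord x (s 1) j := rfl

theorem truncation_map {m n : ℕ} {g : Fin m → Fin n} (hg : Function.Injective g)
    (x : stdSimplex ℝ (Fin m)) (s : stdSimplex ℝ (Fin 2)) :
    truncation n (stdSimplex.map g x, s) = stdSimplex.map g (truncation m (x, s)) := by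
  have hs : 0 ≤ s 1 := stdSimplex.zero_le s 1
  ext j
  rw [truncation_apply, sum_truncatedCoord_map hg x hs]
  by_cases hj : j ∈ Set.range g
  · obtain ⟨i, rfl⟩ := hj
    rw [truncatedCoord_map hg, stdSimplex.map_apply_of_injective hg, truncation_apply]
  · rw [truncatedCoord_map_of_notMem hg x hs hj, stdSimplex.map_apply_of_notMem _ hj, zero_div]

theorem truncation_vertex_zero {n : ℕ} (x : stdSimplex ℝ (Fin n)) :
    truncation n (x, stdSimplex.vertex 0) = x := by
  have h : ∀ i, truncatedCoord x ((stdSimplex.vertex (S := ℝ) (0 : Fin 2)) 1) i = x i := by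
    intro i
    rw [truncatedCoord, stdSimplex.vertex_coe]
    simp
  ext i
  rw [truncation_apply]
  simp only [h]
  rw [stdSimplex.sum_eq_one, div_one]

/-- The end of the truncation homotopy. -/
def truncate (n : ℕ) : C(stdSimplex ℝ (Fin n), stdSimplex ℝ (Fin n)) :=
  (truncation n).comp ((ContinuousMap.id _).prodMk
    (ContinuousMap.const _ (stdSimplex.vertex 1)))

theorem truncate_map {m n : ℕ} {g : Fin m → Fin n} (hg : Function.Injective g)
    (x : stdSimplex ℝ (Fin m)) :
    truncate n (stdSimplex.map g x) = stdSimplex.map g (truncate m x) :=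
  truncation_map hg x _

/-- Truncation thus moves a point whose coordinates off a face are small into that face. -/
theorem truncate_apply_eq_zero {n : ℕ} (x : stdSimplex ℝ (Fin n)) (i : Fin n)
    (h : x i ≤ truncationLevel x) : truncate n x i = 0 := by
  change truncation n (x, stdSimplex.vertex 1) i = 0
  rw [truncation_apply, truncatedCoord, stdSimplex.vertex_coe, Pi.single_eq_same, one_mul,
    max_eq_right (sub_nonpos.2 h), zero_div]

end Truncation

/-! ### Lifting simplices -/

section Lifting

/-- A retraction of the cube onto the standard simplex contained in it. -/
def cubeRetraction (n : ℕ) : C(Fin (n + 1) → unitInterval, stdSimplex ℝ (Fin (n + 1))) where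
  toFun a := ⟨fun i => ((a i : ℝ) + max (1 - ∑ j, (a j : ℝ)) 0 / (n + 1)) / max (∑ j, (a j : ℝ)) 1,
    fun i => div_nonneg (add_nonneg (a i).2.1 (div_nonneg (le_max_right _ _) (by positivity)))
      (zero_le_one.trans (le_max_right _ _)), by
    have h : (0 : ℝ) < max (∑ j, (a j : ℝ)) 1 := lt_max_of_lt_right zero_lt_one
    rw [← Finset.sum_div, div_eq_one_iff_eq h.ne', Finset.sum_add_distrib, Finset.sum_const,
      Finset.card_univ, Fintype.card_fin, nsmul_eq_mul]
    push_cast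
    rw [mul_div_cancel₀ _ (by positivity : (n + 1 : ℝ) ≠ 0)]
    rcases le_total (∑ j, (a j : ℝ)) 1 with h | h
    · rw [max_eq_left (by linarith), max_eq_right h]
      ring
    · rw [max_eq_right (by linarith), max_eq_left h, add_zero]⟩
  continuous_toFun := by
    refine Continuous.subtype_mk (continuous_pi fun i => Continuous.div ?_ ?_ fun a => ?_) _
    · fun_prop
    · fun_prop
    · exact (lt_max_of_lt_right zero_lt_one).ne'

/-- The inclusion of the standard simplex into the cube. -/
def cubeInclusion (n : ℕ) : C(stdSimplex ℝ (Fin (n + 1)), Fin (n + 1) → unitInterval) where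
  toFun x i := ⟨x i, stdSimplex.zero_le x i, stdSimplex.le_one x i⟩
  continuous_toFun := continuous_pi fun i => (continuous_stdSimplex_apply i).subtype_mk _

theorem cubeRetraction_cubeInclusion (n : ℕ) (x : stdSimplex ℝ (Fin (n + 1))) :
    cubeRetraction n (cubeInclusion n x) = x := by
  refine Subtype.ext (funext fun i => ?_)
  change (x i + max (1 - ∑ j, x j) 0 / (n + 1)) / max (∑ j, x j) 1 = x i
  rw [stdSimplex.sum_eq_one]
  simp

/-- The simplex is a retract of a cube, and scaling contracts the cube to its origin. The homotopy
`H` therefore starts at a constant map, which lifts by surjectivity; the end of the lifted homotopy,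
restricted to the simplex, is the lift. -/
theorem IsSerreFibration.exists_lift {E B : Type u} [TopologicalSpace E] [TopologicalSpace B]
    {p : C(E, B)} (hp : IsSerreFibration p) (hsurj : Function.Surjective p) {k : ℕ}
    (σ : SingularSimplex B k) : ∃ τ : SingularSimplex E k, p.comp τ = σ := by
  let H : C((Fin (k + 1) → unitInterval) × unitInterval, B) :=
    (σ.comp (cubeRetraction k)).comp ⟨fun z i => z.2 * z.1 i, by fun_prop⟩
  obtain ⟨e, he⟩ := hsurj (σ (cubeRetraction k 0))
  obtain ⟨F, -, hF⟩ := hp (k + 1) H (ContinuousMap.const _ e) (fun x => by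
    change p e = σ (cubeRetraction k fun i => 0 * x i)
    rw [he]
    simp only [zero_mul]
    rfl)
  refine ⟨F.comp ((cubeInclusion k).prodMk (ContinuousMap.const _ 1)),
    ContinuousMap.ext fun x => ?_⟩
  change p (F (cubeInclusion k x, 1)) = σ x
  rw [hF]
  change σ (cubeRetraction k fun i => 1 * cubeInclusion k x i) = σ x
  simp only [one_mul]
  exact congrArg σ (cubeRetraction_cubeInclusion k x)

end Lifting

/-! ### Partial points and the fibrewise join -/

section PartialPoint

/-- The points of `E` together with an undefined value, whose only neighbourhood is the whole
space. Continuous maps to this space are partial maps to `E` with open domain of definition. -/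
inductive PartialPoint (E : Type u) : Type u
  | none : PartialPoint E
  | some : E → PartialPoint E

instance (E : Type u) [TopologicalSpace E] : TopologicalSpace (PartialPoint E) where
  IsOpen s := (PartialPoint.none ∈ s → s = Set.univ) ∧ IsOpen (PartialPoint.some ⁻¹' s)
  isOpen_univ := ⟨fun _ => rfl, isOpen_univ⟩
  isOpen_inter s t hs ht :=
    ⟨fun h => by rw [hs.1 h.1, ht.1 h.2, Set.univ_inter], hs.2.inter ht.2⟩
  isOpen_sUnion S hS := by
    refine ⟨fun ⟨s, hs, h⟩ => ?_, ?_⟩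
    · exact Set.eq_univ_of_univ_subset ((hS s hs).1 h ▸ Set.subset_sUnion_of_mem hs)
    · rw [Set.preimage_sUnion]
      exact isOpen_biUnion fun s hs => (hS s hs).2

variable {E : Type u} {Y : Type*} [TopologicalSpace E] [TopologicalSpace Y]

theorem PartialPoint.some_injective {E : Type u} :
    Function.Injective (PartialPoint.some : E → PartialPoint E) :=
  fun _ _ => PartialPoint.some.inj

theorem PartialPoint.isOpen_iff {s : Set (PartialPoint E)} :
    IsOpen s ↔ (PartialPoint.none ∈ s → s = Set.univ) ∧ IsOpen (PartialPoint.some ⁻¹' s) :=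
  Iff.rfl

theorem PartialPoint.isOpen_image_some {W : Set E} (hW : IsOpen W) :
    IsOpen (PartialPoint.some '' W) := by
  rw [isOpen_iff, Set.preimage_image_eq _ some_injective]
  refine ⟨fun h => ?_, hW⟩
  obtain ⟨e, _, h⟩ := h
  cases h

/-- The only open set that contains `none` is the whole space, so the images of open sets of `E`
suffice for testing continuity. -/
theorem PartialPoint.continuous_of_isOpen_preimage {f : Y → PartialPoint E}
    (h : ∀ W : Set E, IsOpen W → IsOpen (f ⁻¹' (PartialPoint.some '' W))) : Continuous f := by
  refine ⟨fun s hs => ?_⟩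
  by_cases hn : PartialPoint.none ∈ s
  · rw [hs.1 hn]
    exact isOpen_univ
  · convert h _ hs.2 using 2
    ext z
    constructor
    · intro hz
      cases z with
      | none => exact (hn hz).elim
      | some e => exact ⟨e, hz, rfl⟩
    · rintro ⟨e, he, rfl⟩
      exact he

end PartialPoint

/-! ### A test space over the base with genus at most `n`. -/

section FibrewiseJoin

variable {E B : Type u} [TopologicalSpace E] [TopologicalSpace B]

/-- A coarse version of the fibrewise join: points of the base with `n` partially defined points
of the fibre, at least one of which is defined. -/
def FibrewiseJoin (p : C(E, B)) (n : ℕ) : Type u :=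
  {z : B × (Fin n → PartialPoint E) //
    (∃ j e, z.2 j = .some e) ∧ ∀ j e, z.2 j = .some e → p e = z.1}

instance (p : C(E, B)) (n : ℕ) : TopologicalSpace (FibrewiseJoin p n) :=
  inferInstanceAs (TopologicalSpace (Subtype _))

/-- The projection of the fibrewise join. -/
def FibrewiseJoin.proj (p : C(E, B)) (n : ℕ) : C(FibrewiseJoin p n, B) :=
  ⟨fun z => z.1.1, continuous_fst.comp continuous_subtype_val⟩

/-- The set where the `j`-th partial point is defined is open, and there that point is a lift of the
projection. At every point of the join some entry is defined. -/
theorem FibrewiseJoin.schwarzGenus_le (p : C(E, B)) (n : ℕ) :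
    schwarzGenus (pullbackMap (FibrewiseJoin.proj p n) p) ≤ n := by
  rw [schwarzGenus_le_iff, hasSectionalCover_pullbackMap_iff]
  have hc : ∀ j, Continuous fun z : FibrewiseJoin p n => z.1.2 j := fun j =>
    (continuous_apply j).comp (continuous_snd.comp continuous_subtype_val)
  refine ⟨fun j => {z | ∃ e, z.1.2 j = .some e}, fun j => ?_, ?_, fun j => ?_⟩
  · convert (PartialPoint.isOpen_image_some (isOpen_univ (X := E))).preimage (hc j) using 1
    ext z
    constructor
    · exact fun ⟨e, he⟩ => ⟨e, trivial, he.symm⟩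
    · exact fun ⟨e, _, he⟩ => ⟨e, he.symm⟩
  · exact Set.eq_univ_of_forall fun z => Set.mem_iUnion.2 z.2.1
  · refine ⟨⟨fun z => z.2.choose, ?_⟩, fun z => z.1.2.2 j _ z.2.choose_spec⟩
    refine ⟨fun W hW => ?_⟩
    convert (PartialPoint.isOpen_image_some hW).preimage ((hc j).comp continuous_subtype_val)
      using 1
    ext z
    constructor
    · exact fun hz => ⟨_, hz, z.2.choose_spec.symm⟩
    · rintro ⟨e, he, h⟩
      have h' : PartialPoint.some e = .some z.2.choose := Eq.trans h z.2.choose_spec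
      change z.2.choose ∈ W
      rwa [← PartialPoint.some_injective h']

end FibrewiseJoin

/-! ### Lifting simplices to the fibrewise join -/

section FaceNeighbourhood

/-- A neighbourhood of the interior of the truncation of a face `g` of a standard simplex. -/
def faceNeighbourhood {j k : ℕ} (g : Fin j ↪o Fin k) : Set (stdSimplex ℝ (Fin k)) :=
  {x | (∀ i, 0 < x (g i)) ∧ (∀ l, l ∉ Set.range g → ∀ i, x l < x (g i)) ∧
    ∀ l, l ∉ Set.range g → x l < truncationLevel x}

variable {j k : ℕ}

theorem isOpen_faceNeighbourhood (g : Fin j ↪o Fin k) : IsOpen (faceNeighbourhood g) := by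
  have h : ∀ l, Continuous fun x : stdSimplex ℝ (Fin k) => x l := continuous_stdSimplex_apply
  simp only [faceNeighbourhood, Set.ofPred_and, Set.ofPred_forall]
  refine (isOpen_iInter_of_finite fun i => isOpen_lt continuous_const (h _)).inter
    ((isOpen_iInter_of_finite fun l => isOpen_iInter_of_finite fun _ =>
      isOpen_iInter_of_finite fun i => isOpen_lt (h _) (h _)).inter
    (isOpen_iInter_of_finite fun l => isOpen_iInter_of_finite fun _ =>
      isOpen_lt (h _) continuous_truncationLevel))

/-- Two different vertex sets of equal size each contain a vertex missing from the other, and each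
of these two coordinates would have to exceed the other. So neighbourhoods of different faces of one
dimension are disjoint. -/
theorem eq_of_mem_faceNeighbourhood {g g' : Fin j ↪o Fin k} {x : stdSimplex ℝ (Fin k)}
    (h : x ∈ faceNeighbourhood g) (h' : x ∈ faceNeighbourhood g') : g = g' := by
  have key : ∀ {g g' : Fin j ↪o Fin k}, x ∈ faceNeighbourhood g → x ∈ faceNeighbourhood g' →
      Set.range g ⊆ Set.range g' := by
    intro g g' h h'
    by_contra hne
    obtain ⟨_, ⟨i, rfl⟩, hi⟩ := Set.not_subset.1 hne
    have : ∃ i', g' i' ∉ Set.range g := by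
      by_contra! hall
      have hsub : Set.range g' ⊆ Set.range g := by
        rintro _ ⟨i', rfl⟩
        exact hall i'
      have heq := Set.eq_of_subset_of_ncard_le hsub (by
        rw [← Set.image_univ, ← Set.image_univ, Set.ncard_image_of_injective _ g.injective,
          Set.ncard_image_of_injective _ g'.injective]) (Set.finite_range g)
      exact hi (heq ▸ ⟨i, rfl⟩)
    obtain ⟨i', hi'⟩ := this
    exact lt_asymm (h.2.1 _ hi' i) (h'.2.1 _ hi i')
  have hr : Set.range g = Set.range g' := (key h h').antisymm (key h' h)
  exact OrderEmbedding.range_inj.1 hr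

/-- The vertices whose coordinates reach the truncation level span the required face. Only the
dimensions `0, …, k` occur, so `k + 1` partial points will suffice for a `k`-simplex. -/
theorem exists_mem_faceNeighbourhood {k : ℕ} (x : stdSimplex ℝ (Fin (k + 1))) :
    ∃ j ≤ k, ∃ g : Fin (j + 1) ↪o Fin (k + 1), x ∈ faceNeighbourhood g := by
  classical
  let S : Finset (Fin (k + 1)) := {i | truncationLevel x ≤ x i}
  obtain ⟨i, hi⟩ := exists_truncationLevel_lt x
  have hpos : 0 < S.card := Finset.card_pos.2 ⟨i, by simp [S, hi.le]⟩
  have hle : S.card ≤ k + 1 := by simpa using S.card_le_univ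
  have hmem : ∀ i, i ∈ S ↔ truncationLevel x ≤ x i := fun i => by simp [S]
  refine ⟨S.card - 1, by omega, S.orderEmbOfFin (by omega), fun i => ?_, fun l hl i => ?_,
    fun l hl => ?_⟩
  · exact (truncationLevel_pos x).trans_le ((hmem _).1 (S.orderEmbOfFin_mem _ i))
  · rw [Finset.range_orderEmbOfFin, Finset.mem_coe, hmem, not_le] at hl
    exact hl.trans_le ((hmem _).1 (S.orderEmbOfFin_mem _ i))
  · rwa [Finset.range_orderEmbOfFin, Finset.mem_coe, hmem, not_le] at hl

theorem map_mem_faceNeighbourhood {m : ℕ} (d : Fin k ↪o Fin m) (g : Fin j ↪o Fin k)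
    {x : stdSimplex ℝ (Fin k)} (h : x ∈ faceNeighbourhood g) :
    stdSimplex.map d x ∈ faceNeighbourhood (g.trans d) := by
  have hd : ∀ i, stdSimplex.map d x (d i) = x i := stdSimplex.map_apply_of_injective d.injective x
  have h0 : ∀ l, l ∉ Set.range d → stdSimplex.map d x l = 0 := fun l =>
    stdSimplex.map_apply_of_notMem x
  refine ⟨fun i => ?_, fun l hl i => ?_, fun l hl => ?_⟩
  · exact (hd _).symm ▸ h.1 i
  · change _ < stdSimplex.map d x (d (g i))
    rw [hd]
    by_cases hld : l ∈ Set.range d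
    · obtain ⟨l, rfl⟩ := hld
      rw [hd]
      exact h.2.1 l (fun ⟨a, ha⟩ => hl ⟨a, congrArg d ha⟩) i
    · rw [h0 l hld]
      exact h.1 i
  · rw [truncationLevel_map d.injective]
    by_cases hld : l ∈ Set.range d
    · obtain ⟨l, rfl⟩ := hld
      rw [hd]
      exact h.2.2 l fun ⟨a, ha⟩ => hl ⟨a, congrArg d ha⟩
    · rw [h0 l hld]
      exact truncationLevel_pos x

/-- The coordinates along `g` are positive, so `g` must be a face of `d`. Hence partial lifts have
the same domain on a face as on the whole simplex. -/
theorem exists_of_map_mem_faceNeighbourhood {m : ℕ} (d : Fin k ↪o Fin m) (g : Fin j ↪o Fin m)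
    {x : stdSimplex ℝ (Fin k)} (h : stdSimplex.map d x ∈ faceNeighbourhood g) :
    ∃ g' : Fin j ↪o Fin k, x ∈ faceNeighbourhood g' := by
  have hd : ∀ i, stdSimplex.map d x (d i) = x i := stdSimplex.map_apply_of_injective d.injective x
  have hr : ∀ i, ∃ l, d l = g i := by
    intro i
    by_contra hi
    have := h.1 i
    rw [stdSimplex.map_apply_of_notMem x hi] at this
    exact lt_irrefl _ this
  choose g' hg' using hr
  have hg'' : StrictMono g' := fun a b hab => by
    rw [← d.lt_iff_lt, hg', hg']
    exact g.strictMono hab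
  have hmem : ∀ l, l ∉ Set.range g' → d l ∉ Set.range g := by
    rintro l hl ⟨i, hi⟩
    exact hl ⟨i, d.injective ((hg' i).trans hi)⟩
  refine ⟨OrderEmbedding.ofStrictMono g' hg'', fun i => ?_, fun l hl i => ?_, fun l hl => ?_⟩
  · change 0 < x (g' i)
    rw [← hd, hg']
    exact h.1 i
  · change x l < x (g' i)
    rw [← hd, ← hd (g' i), hg']
    exact h.2.1 _ (hmem l hl) i
  · rw [← hd, ← truncationLevel_map d.injective]
    exact h.2.2 _ (hmem l hl)

/-- The truncation of a point in a face neighbourhood, as a point of that face. -/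
def faceTruncation (g : Fin j ↪o Fin k) : C(faceNeighbourhood g, stdSimplex ℝ (Fin j)) where
  toFun x := ⟨fun i => truncate k x.1 (g i), fun i => stdSimplex.zero_le _ _, by
    rw [← stdSimplex.sum_eq_one (truncate k x.1)]
    exact Fintype.sum_of_injective g g.injective _ _
      (fun l hl => truncate_apply_eq_zero _ _ (x.2.2.2 l hl).le) fun i => rfl⟩
  continuous_toFun := by
    refine Continuous.subtype_mk (continuous_pi fun i => ?_) _
    exact (continuous_stdSimplex_apply _).comp
      ((truncate k).continuous.comp continuous_subtype_val)

theorem faceTruncation_apply (g : Fin j ↪o Fin k) (x : faceNeighbourhood g) (i : Fin j) :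
    faceTruncation g x i = truncate k x.1 (g i) := rfl

theorem map_faceTruncation (g : Fin j ↪o Fin k) (x : faceNeighbourhood g) :
    stdSimplex.map g (faceTruncation g x) = truncate k x.1 := by
  refine Subtype.ext (funext fun l => ?_)
  change stdSimplex.map g (faceTruncation g x) l = truncate k x.1 l
  by_cases hl : l ∈ Set.range g
  · obtain ⟨i, rfl⟩ := hl
    rw [stdSimplex.map_apply_of_injective g.injective, faceTruncation_apply]
  · rw [stdSimplex.map_apply_of_notMem _ hl, truncate_apply_eq_zero _ _ (x.2.2.2 l hl).le]

theorem faceTruncation_map {m : ℕ} (d : Fin k ↪o Fin m) (g : Fin j ↪o Fin k)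
    (x : faceNeighbourhood g) :
    faceTruncation (g.trans d) ⟨_, map_mem_faceNeighbourhood d g x.2⟩ = faceTruncation g x := by
  refine Subtype.ext (funext fun i => ?_)
  change truncate m (stdSimplex.map d x.1) (d (g i)) = truncate k x.1 (g i)
  rw [truncate_map d.injective, stdSimplex.map_apply_of_injective d.injective]

end FaceNeighbourhood

/-! ### Assembling incompatible lifts of faces into a natural lift. -/

section PartialLift

variable {E B : Type u} [TopologicalSpace E] [TopologicalSpace B] {p : C(E, B)}
  (lift : ∀ k, SingularSimplex B k → SingularSimplex E k)

open Classical in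
/-- The partial lift of a truncated simplex that is given by chosen lifts of its `j`-faces. -/
def partialLift {k : ℕ} (σ : SingularSimplex B k) (j : ℕ) (x : stdSimplex ℝ (Fin (k + 1))) :
    PartialPoint E :=
  if h : ∃ g : Fin (j + 1) ↪o Fin (k + 1), x ∈ faceNeighbourhood g then
    .some (lift j (σ.reindex h.choose) (faceTruncation h.choose ⟨x, h.choose_spec⟩))
  else .none

/-- Disjointness of the neighbourhoods in one dimension makes the choice of `g` irrelevant. -/
theorem partialLift_of_mem {k : ℕ} (σ : SingularSimplex B k) {j : ℕ}
    {g : Fin (j + 1) ↪o Fin (k + 1)} (x : faceNeighbourhood g) :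
    partialLift lift σ j x = .some (lift j (σ.reindex g) (faceTruncation g x)) := by
  have h : ∃ g : Fin (j + 1) ↪o Fin (k + 1), x.1 ∈ faceNeighbourhood g := ⟨g, x.2⟩
  rw [partialLift, dif_pos h]
  have : ∀ (g' : Fin (j + 1) ↪o Fin (k + 1)) (hx : x.1 ∈ faceNeighbourhood g'),
      (.some (lift j (σ.reindex g') (faceTruncation g' ⟨x, hx⟩)) : PartialPoint E) =
        .some (lift j (σ.reindex g) (faceTruncation g x)) := by
    intro g' hx
    obtain rfl := eq_of_mem_faceNeighbourhood hx x.2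
    rfl
  exact this _ h.choose_spec

theorem partialLift_eq_some {k : ℕ} {σ : SingularSimplex B k} {j : ℕ}
    {x : stdSimplex ℝ (Fin (k + 1))} {e : E} (h : partialLift lift σ j x = .some e) :
    ∃ (g : Fin (j + 1) ↪o Fin (k + 1)) (hx : x ∈ faceNeighbourhood g),
      e = lift j (σ.reindex g) (faceTruncation g ⟨x, hx⟩) := by
  by_cases hx : ∃ g : Fin (j + 1) ↪o Fin (k + 1), x ∈ faceNeighbourhood g
  · obtain ⟨g, hg⟩ := hx
    exact ⟨g, hg, PartialPoint.some_injective (h.symm.trans (partialLift_of_mem lift σ ⟨x, hg⟩))⟩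
  · rw [partialLift, dif_neg hx] at h
    cases h

theorem continuous_partialLift {k : ℕ} (σ : SingularSimplex B k) (j : ℕ) :
    Continuous (partialLift lift σ j) := by
  refine PartialPoint.continuous_of_isOpen_preimage fun W hW => ?_
  have : partialLift lift σ j ⁻¹' (PartialPoint.some '' W) =
      ⋃ g : Fin (j + 1) ↪o Fin (k + 1), Subtype.val ''
        ((fun x => lift j (σ.reindex g) (faceTruncation g x)) ⁻¹' W) := by
    ext x
    simp only [Set.mem_iUnion, Set.mem_image, Set.mem_preimage]
    constructor
    · rintro ⟨e, he, hx⟩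
      obtain ⟨g, hg, rfl⟩ := partialLift_eq_some lift hx.symm
      exact ⟨g, ⟨x, hg⟩, he, rfl⟩
    · rintro ⟨g, x, hx, rfl⟩
      exact ⟨_, hx, (partialLift_of_mem lift σ x).symm⟩
  rw [this]
  refine isOpen_iUnion fun g => (isOpen_faceNeighbourhood g).isOpenMap_subtype_val _ ?_
  exact hW.preimage ((lift j (σ.reindex g)).continuous.comp (faceTruncation g).continuous)

/-- The value depends only on the truncated point and on the face as a singular simplex of `B`.
Naturality therefore holds although the chosen lifts are unrelated. -/
theorem partialLift_reindex {k m : ℕ} (σ : SingularSimplex B m) (d : Fin (k + 1) ↪o Fin (m + 1))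
    (j : ℕ) (x : stdSimplex ℝ (Fin (k + 1))) :
    partialLift lift (σ.reindex d) j x = partialLift lift σ j (stdSimplex.map d x) := by
  by_cases hx : ∃ g : Fin (j + 1) ↪o Fin (k + 1), x ∈ faceNeighbourhood g
  · obtain ⟨g, hg⟩ := hx
    rw [partialLift_of_mem lift _ ⟨x, hg⟩,
      partialLift_of_mem lift σ ⟨_, map_mem_faceNeighbourhood d g hg⟩,
      faceTruncation_map d g ⟨x, hg⟩, SingularSimplex.reindex_reindex]
    rfl
  · rw [partialLift, dif_neg hx, partialLift, dif_neg]
    exact fun ⟨g, hg⟩ => hx (exists_of_map_mem_faceNeighbourhood d g hg)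

theorem partialLift_mem_fibrewiseJoin (hlift : ∀ k σ, p.comp (lift k σ) = σ) {n k : ℕ}
    (hk : k < n) (σ : SingularSimplex B k) (x : stdSimplex ℝ (Fin (k + 1))) :
    (∃ (j : Fin n) (e : E), partialLift lift σ j x = .some e) ∧
      ∀ (j : Fin n) (e : E), partialLift lift σ j x = .some e → p e = σ (truncate _ x) := by
  refine ⟨?_, fun j e h => ?_⟩
  · obtain ⟨j, hj, g, hg⟩ := exists_mem_faceNeighbourhood x
    exact ⟨⟨j, by omega⟩, _, partialLift_of_mem lift σ ⟨x, hg⟩⟩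
  · obtain ⟨g, hg, rfl⟩ := partialLift_eq_some lift h
    have := DFunLike.congr_fun (hlift j (σ.reindex g)) (faceTruncation g ⟨x, hg⟩)
    exact this.trans (congrArg σ (map_faceTruncation g ⟨x, hg⟩))

/-- The lift of a truncated simplex to the fibrewise join. -/
def joinLift (hlift : ∀ k σ, p.comp (lift k σ) = σ) (n : ℕ) {k : ℕ} (hk : k < n)
    (σ : SingularSimplex B k) : SingularSimplex (FibrewiseJoin p n) k where
  toFun x := ⟨(σ (truncate _ x), fun j => partialLift lift σ j x),
    partialLift_mem_fibrewiseJoin lift hlift hk σ x⟩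
  continuous_toFun := Continuous.subtype_mk ((σ.continuous.comp (truncate _).continuous).prodMk
    (continuous_pi fun _ => continuous_partialLift lift σ _)) _

/-- Makes `joinLift` compatible with coboundaries in the degrees below `n`. -/
theorem joinLift_face (hlift : ∀ k σ, p.comp (lift k σ) = σ) (n : ℕ) {k : ℕ} (hk : k + 1 < n)
    (σ : SingularSimplex B (k + 1)) (i : Fin (k + 2)) :
    (joinLift lift hlift n hk σ).face i =
      joinLift lift hlift n ((Nat.lt_succ_self k).trans hk) (σ.face i) := by
  refine ContinuousMap.ext fun x => Subtype.ext (Prod.ext ?_ (funext fun j => ?_))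
  · exact congrArg σ (truncate_map i.succAboveOrderEmb.injective x)
  · exact (partialLift_reindex lift σ i.succAboveOrderEmb j x).symm

end PartialLift

/-- For a surjective Serre fibration, a class of degree `n` that dies in the fibrewise join is
zero. -/
theorem IsSerreFibration.eq_zero_of_pullback_proj_eq_zero {R : Type v} [CommRing R]
    {E B : Type u} [TopologicalSpace E] [TopologicalSpace B] {p : C(E, B)}
    (hp : IsSerreFibration p) (hsurj : Function.Surjective p) {n : ℕ}
    (x : SingularCohomology R B n)
    (hx : SingularCohomology.pullback R (FibrewiseJoin.proj p (n + 1)) n x = 0) : x = 0 := by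
  obtain ⟨φ, rfl⟩ := SingularCohomology.mk_surjective n x
  rw [SingularCohomology.pullback_mk, SingularCohomology.mk_eq_zero] at hx
  rw [SingularCohomology.mk_eq_zero]
  choose lift hlift using fun k (σ : SingularSimplex B k) => hp.exists_lift hsurj σ
  refine SingularCochain.mem_boundary_of_homotopy (fun k => truncation (k + 1))
    (fun k i x s => truncation_map i.succAbove_right_injective x s)
    (fun k x => truncation_vertex_zero x) φ.1 (LinearMap.mem_ker.1 φ.2) ?_
  -- By construction `joinLift σ` projects to the truncated simplex.
  have hval : ∀ σ : SingularSimplex B n, φ.1 (σ.comp (truncate (n + 1))) =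
      SingularCochain.pullback R (FibrewiseJoin.proj p (n + 1)) n φ.1
        (joinLift lift hlift (n + 1) (Nat.lt_succ_self n) σ) := fun σ => rfl
  cases n with
  | zero =>
    refine (funext fun σ => ?_ : _ = (0 : SingularCochain R B 0))
    exact (hval σ).trans (congrFun hx _)
  | succ n =>
    obtain ⟨ψ, hψ⟩ := hx
    -- A primitive on the join, composed with the natural lift, is a primitive of the truncated
    -- cocycle.
    refine ⟨fun τ => ψ (joinLift lift hlift (n + 2) (by omega) τ), funext fun σ => ?_⟩
    refine Eq.trans ?_ ((congrFun hψ _).trans (hval σ).symm)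
    rw [singularCoboundary_apply, singularCoboundary_apply]
    exact Finset.sum_congr rfl fun i _ => by rw [joinLift_face]

theorem IsSerreFibration.sectionalWeight_lt_schwarzGenus {R : Type v} [CommRing R]
    {E B : Type u} [TopologicalSpace E] [TopologicalSpace B] {p : C(E, B)}
    (hp : IsSerreFibration p) (hsurj : Function.Surjective p) (ξ : TotalCohomology R B)
    (hξ : ξ ≠ 0) : sectionalWeight p ξ < schwarzGenus p := by
  refine _root_.sectionalWeight_lt_schwarzGenus p ξ hξ ?_
  have : ∃ n, ξ n ≠ 0 := by
    by_contra! h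
    exact hξ (DFinsupp.ext h)
  obtain ⟨n, hn⟩ := this
  -- A nonzero component of degree `n` is detected with `n + 1` partial points, one for each
  -- dimension of a face of an `n`-simplex.
  exact ⟨FibrewiseJoin p (n + 1), inferInstance, FibrewiseJoin.proj p (n + 1), n + 1,
    FibrewiseJoin.schwarzGenus_le p (n + 1), fun h =>
      hn (hp.eq_zero_of_pullback_proj_eq_zero hsurj _ (DFunLike.congr_fun h n))⟩

end

theorem theorem6p4 {R : Type v} [CommRing R] {E B : Type u} [TopologicalSpace E]
    [TopologicalSpace B] (p : C(E, B)) (hp : IsSerreFibration p) (hsurj : Function.Surjective p) :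
    (∀ ξ : TotalCohomology R B,
      1 ≤ sectionalWeight p ξ ↔ TotalCohomology.pullback R p ξ = 0) ∧
    (∀ ξ : TotalCohomology R B, ξ ≠ 0 → sectionalWeight p ξ < schwarzGenus p) ∧
    (∀ (l : ℕ) (ξ : Fin l → TotalCohomology R B),
      ∑ i, sectionalWeight p (ξ i) ≤ sectionalWeight p (List.ofFn ξ).prod) ∧
    (∀ (l : ℕ) (ξ : Fin l → TotalCohomology R B),
      (∀ i, ∃ (n : ℕ) (x : SingularCohomology R B n),
        0 < n ∧ ξ i = DirectSum.of (SingularCohomology R B) n x) →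
      (List.ofFn ξ).prod ≠ 0 →
      ∑ i, sectionalWeight p (ξ i) < schwarzGenus p) :=
  ⟨one_le_sectionalWeight_iff p, hp.sectionalWeight_lt_schwarzGenus hsurj,
    sum_sectionalWeight_le_prod p, fun l ξ _ hne =>
      (sum_sectionalWeight_le_prod p l ξ).trans_lt (hp.sectionalWeight_lt_schwarzGenus hsurj _ hne)⟩
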